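/- **Proposition 5.1.** Let $M$ be a Hermitian manifold of complex dimension $n\ge 2$ (with metric of class $C^2$) and let $\Omega\subset M$ be a relatively compact pseudoconvex domain with $C^2$ boundary, i.e. the Levi form $\partial\bar\partial\rho(Z,\bar Z)$ of its $C^2$ defining functions $\rho$ is nonnegative for all $(1,0)$-vectors $Z$ tangent to $\partial\Omega$. Let $U$ be an open neighborhood of $\partial\Omega$ and let $r\in C^2(U)$ be an admissible defining function for $\Omega$: $r<0$ exactly on $\Omega\cap U$, $r=0$ exactly on $\partial\Omega$, $dr\neq 0$ on $\partial\Omega$, and $|dr|\in C^2(U)$. Let $L_r$ be the unique section of $T^{1,0}(U)$ with $$|\partial r|^{-2}\,\partial r(Z)=\langle Z,L_r\rangle\qquad\text{for all } Z\in T^{1,0}(U)$$ (where $dr=0$, put $L_r=0$), and let $\alpha_r$ be D'Angelo's real $1$-form on $U$, defined by $$\alpha_r(Z)=\partial\bar\partial r(Z,\bar L_r),\qquad \alpha_r(\bar Z)=\partial\bar\partial r(L_r,\bar Z)\qquad\text{for all } Z\in T^{1,0}(U),$$ where $\partial\bar\partial r(Z,\bar W)=\sum_{j,k}\frac{\partial^2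 r}{\partial z_j\partial\bar z_k}Z^j\overline{W^k}$ in holomorphic coordinates. Let $S$ be a complex submanifold (possibly only injectively immersed) of $M$ of complex dimension $m\ge1$ with $S\subset\partial\Omega$, and let $\iota_S:S\to M$ be the inclusion. Then: 1. $\iota_S^*\alpha_r$ is continuous and $d_S$-closed in the weak sense: in any smooth coordinate chart of $S$ its coefficient functions are continuous and, writing $\iota_S^*\alpha_r=\sum_j a_j\,dx_j$, one has $\partial_j a_k=\partial_k a_j$ in the sense of distributions. 2. $\iota_S^*\alpha_r$ is locally exact: every point of $S$ has a neighborhood $V\subset S$ and a real function $u\in C^1(V)$ such that $\iota_S^*\alpha_r=d_Su$ on $V$. -/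

import Mathlib

open scoped Manifold ContDiff Topology

noncomputable section

namespace DAngelo

section RealStructure

variable {E : Type*} [NormedAddCommGroup E] [NormedSpace ℂ E]
  {M : Type*} [TopologicalSpace M] [ChartedSpace E M]

/-- A complex manifold modelled on the complex normed space `E` is a real manifold modelled on the
underlying real normed space, with the same charts. -/
instance isManifold_real (n : ℕ∞ω) [h : IsManifold 𝓘(ℂ, E) n M] : IsManifold 𝓘(ℝ, E) n M := by
  apply isManifold_of_contDiffOn
  intro e e' he he'
  have := (contDiffGroupoid n 𝓘(ℂ, E)).compatible he he'
  rw [contDiffGroupoid, mem_groupoid_of_pregroupoid] at this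
  have h1 : ContDiffOn ℂ n (𝓘(ℂ, E) ∘ e.symm ≫ₕ e' ∘ (𝓘(ℂ, E)).symm)
    ((𝓘(ℂ, E)).symm ⁻¹' (e.symm ≫ₕ e').source ∩ Set.range 𝓘(ℂ, E)) := this.1
  exact h1.restrict_scalars ℝ

/-- The complex structure `J` on the real tangent space at `p`: multiplication by `i` in the
holomorphic chart `chartAt E p` by which the tangent space is identified with `E`. -/
def tangentJ (p : M) : TangentSpace 𝓘(ℝ, E) p →ₗ[ℝ] TangentSpace 𝓘(ℝ, E) p :=
  ((Complex.I • LinearMap.id : E →ₗ[ℂ] E).restrictScalars ℝ : E →ₗ[ℝ] E)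

theorem tangentJ_tangentJ (p : M) (v : TangentSpace 𝓘(ℝ, E) p) :
    tangentJ p (tangentJ p v) = -v := by
  have h : ∀ x : E, Complex.I • Complex.I • x = -x := fun x ↦ by
    rw [smul_smul, Complex.I_mul_I, neg_one_smul]
  exact h v

/-- The differential `dr` at `p`. -/
def dAt (r : M → ℝ) (p : M) : TangentSpace 𝓘(ℝ, E) p →ₗ[ℝ] ℝ :=
  ((NormedSpace.fromTangentSpace (𝕜 := ℝ) (r p) : TangentSpace 𝓘(ℝ, ℝ) (r p) →L[ℝ] ℝ).comp
    (mfderiv 𝓘(ℝ, E) 𝓘(ℝ, ℝ) r p)).toLinearMap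

/-- `delAt r p v` is `∂r(Z)` for the `(1,0)`-vector `Z = (v - i J v) / 2`.

Throughout, the `(1,0)`-vector `Z = (v - i J v) / 2` is represented by the real tangent vector
`v = Z + conj Z`.  In a holomorphic chart, `∑ Zʲ ∂/∂zⱼ` is represented by `(Z¹, …, Zⁿ)`. -/
def delAt (r : M → ℝ) (p : M) (v : TangentSpace 𝓘(ℝ, E) p) : ℂ :=
  (1 / 2 : ℂ) * ((dAt r p v : ℝ) - Complex.I * (dAt r p (tangentJ p v) : ℝ))

/-- The real second derivative of `r` at `p` in the holomorphic chart `chartAt E p`. -/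
def hessAt (r : M → ℝ) (p : M) :
    TangentSpace 𝓘(ℝ, E) p →ₗ[ℝ] TangentSpace 𝓘(ℝ, E) p →ₗ[ℝ] ℝ :=
  ((ContinuousLinearMap.coeLM ℝ).comp
    (fderiv ℝ (fderiv ℝ (r ∘ (chartAt E p).symm)) (chartAt E p p) : E →ₗ[ℝ] E →L[ℝ] ℝ) :
      E →ₗ[ℝ] E →ₗ[ℝ] ℝ)

/-- The complex Hessian: `complexHessian r p v w` is
`∂∂̄r(Z, conj W) = ∑ⱼₖ (∂²r/∂zⱼ∂z̄ₖ) Zʲ conj(Wᵏ)` for `Z = (v - i J v) / 2`, `W = (w - i J w) / 2`.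
It does not depend on the choice of the holomorphic chart at `p`. -/
def complexHessian (r : M → ℝ) (p : M) (v w : TangentSpace 𝓘(ℝ, E) p) : ℂ :=
  (1 / 4 : ℂ) *
    (((hessAt r p v w + hessAt r p (tangentJ p v) (tangentJ p w) : ℝ) : ℂ) +
      Complex.I * ((hessAt r p v (tangentJ p w) - hessAt r p (tangentJ p v) w : ℝ) : ℂ))

end RealStructure

section Metric

variable (E : Type*) [NormedAddCommGroup E] [NormedSpace ℂ E]
  (M : Type*) [TopologicalSpace M] [ChartedSpace E M] [IsManifold 𝓘(ℂ, E) ω M]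

/-- A Hermitian metric with `C²` coefficients on the complex manifold `M`: a Riemannian metric for
which `J` is an isometry. -/
structure HermitianMetric extends
    Bundle.ContMDiffRiemannianMetric 𝓘(ℝ, E) 2 E (fun p : M ↦ TangentSpace 𝓘(ℝ, E) p) where
  inner_J : ∀ (p : M) (v w : TangentSpace 𝓘(ℝ, E) p),
    inner p (tangentJ p v) (tangentJ p w) = inner p v w

end Metric

section Alpha

variable {E : Type*} [NormedAddCommGroup E] [NormedSpace ℂ E]
  {M : Type*} [TopologicalSpace M] [ChartedSpace E M] [IsManifold 𝓘(ℂ, E) ω M]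

/-- The sesquilinear inner product `⟨Z, W⟩ = g(Z, conj W)` of `Z = (v - i J v) / 2` and
`W = (w - i J w) / 2`, where `g` is extended to complex vectors bilinearly. -/
def HermitianMetric.herm (g : HermitianMetric E M) (p : M) (v w : TangentSpace 𝓘(ℝ, E) p) : ℂ :=
  (1 / 2 : ℂ) * ((g.inner p v w : ℝ) + Complex.I * (g.inner p v (tangentJ p w) : ℝ))

/-- The dual norm `|dr|` at `p`. -/
def HermitianMetric.normD (g : HermitianMetric E M) (r : M → ℝ) (p : M) : ℝ :=
  sSup {t : ℝ | ∃ v : TangentSpace 𝓘(ℝ, E) p, g.inner p v v ≤ 1 ∧ t = |dAt r p v|}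

/-- The dual norm `|∂r|` at `p`. -/
def HermitianMetric.normDel (g : HermitianMetric E M) (r : M → ℝ) (p : M) : ℝ :=
  sSup {t : ℝ | ∃ v : TangentSpace 𝓘(ℝ, E) p, (g.herm p v v).re ≤ 1 ∧ t = ‖delAt r p v‖}

theorem HermitianMetric.inner_J_right (g : HermitianMetric E M) (p : M)
    (v w : TangentSpace 𝓘(ℝ, E) p) :
    g.inner p v (tangentJ p w) = - g.inner p (tangentJ p v) w := by
  rw [← g.inner_J p v (tangentJ p w), tangentJ_tangentJ, map_neg]

/-- There is exactly one `(1,0)`-vector `L` at `p` with `|∂r|⁻² ∂r(Z) = ⟨Z, L⟩` for all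
`(1,0)`-vectors `Z`. -/
theorem HermitianMetric.existsUnique_L [FiniteDimensional ℂ E] (g : HermitianMetric E M)
    (r : M → ℝ) (p : M) :
    ∃! L : TangentSpace 𝓘(ℝ, E) p, ∀ v : TangentSpace 𝓘(ℝ, E) p,
      (((g.normDel r p) ^ 2)⁻¹ : ℂ) * delAt r p v = g.herm p v L := by
  have : FiniteDimensional ℝ (TangentSpace 𝓘(ℝ, E) p) :=
    inferInstanceAs (FiniteDimensional ℝ E)
  let B : TangentSpace 𝓘(ℝ, E) p →ₗ[ℝ] Module.Dual ℝ (TangentSpace 𝓘(ℝ, E) p) :=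
    { toFun := fun v ↦ (g.inner p v : TangentSpace 𝓘(ℝ, E) p →ₗ[ℝ] ℝ)
      map_add' := by intro v w; ext x; simp
      map_smul' := by intro v w; ext x; simp }
  have hinj : Function.Injective B := by
    rw [← LinearMap.ker_eq_bot, LinearMap.ker_eq_bot']
    intro v hv
    by_contra hne
    have h1 := g.pos p v hne
    have h2 : B v v = 0 := by rw [hv]; rfl
    exact absurd h2 h1.ne'
  have hsurj : Function.Surjective B :=
    (LinearMap.injective_iff_surjective_of_finrank_eq_finrank
      (Subspace.dual_finrank_eq).symm).1 hinj
  obtain ⟨L, hL⟩ := hsurj ((((g.normDel r p) ^ 2)⁻¹ : ℝ) • dAt r p)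
  have hL' : ∀ w, g.inner p w L = ((g.normDel r p) ^ 2)⁻¹ * dAt r p w := by
    intro w
    rw [g.symm p w L]
    exact congrArg (fun f ↦ f w) hL
  refine ⟨L, ?_, ?_⟩
  · intro v
    rw [HermitianMetric.herm, g.inner_J_right, hL', hL', delAt]
    push_cast
    ring
  · intro L' h
    apply hinj
    ext w
    have h1 := h w
    rw [HermitianMetric.herm, delAt] at h1
    have h2 := congrArg Complex.re h1
    have h3 : g.inner p w L' = ((g.normDel r p) ^ 2)⁻¹ * dAt r p w := by
      have e1 : (((g.normDel r p) ^ 2)⁻¹ : ℂ) = ((((g.normDel r p) ^ 2)⁻¹ : ℝ) : ℂ) := by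
        push_cast; rfl
      rw [e1, Complex.re_ofReal_mul] at h2
      simp at h2
      linarith
    change g.inner p L' w = g.inner p L w
    rw [g.symm p L' w, g.symm p L w, h3, hL']

/-- The section `L_r` of `T^{1,0}`: the unique one with `|∂r|⁻² ∂r(Z) = ⟨Z, L_r⟩` for all `Z`. -/
def HermitianMetric.L [FiniteDimensional ℂ E] (g : HermitianMetric E M) (r : M → ℝ) (p : M) :
    TangentSpace 𝓘(ℝ, E) p :=
  (g.existsUnique_L r p).choose

/-- A (real-valued, not necessarily continuous) `1`-form on `M`. -/
abbrev OneForm (E : Type*) [NormedAddCommGroup E] [NormedSpace ℂ E]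
    (M : Type*) [TopologicalSpace M] [ChartedSpace E M] : Type _ :=
  ∀ p : M, TangentSpace 𝓘(ℝ, E) p →ₗ[ℝ] ℝ

/-- D'Angelo's real `1`-form `α_r`, given by `α_r(Z) = ∂∂̄r(Z, conj L_r)` and
`α_r(conj Z) = ∂∂̄r(L_r, conj Z)`.  On a real vector `v = Z + conj Z` its value is
`∂∂̄r(Z, conj L_r) + ∂∂̄r(L_r, conj Z)`, a real number as the two terms are complex conjugates. -/
def alpha [FiniteDimensional ℂ E] (g : HermitianMetric E M) (r : M → ℝ) : OneForm E M := fun p ↦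
  { toFun := fun v ↦ (complexHessian r p v (g.L r p) + complexHessian r p (g.L r p) v).re
    map_add' := by
      intro v w
      simp [complexHessian]
      ring
    map_smul' := by
      intro c v
      simp [complexHessian]
      ring }

end Alpha

section Domains

variable {E : Type*} [NormedAddCommGroup E] [NormedSpace ℂ E]
  {M : Type*} [TopologicalSpace M] [ChartedSpace E M]

/-- `r` is a `C²` defining function for `Ω` on the open neighbourhood `U` of the boundary of `Ω`. -/
structure IsDefiningFunction (Ω U : Set M) (r : M → ℝ) : Prop where
  isOpen : IsOpen U
  frontier_subset : frontier Ω ⊆ U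
  contMDiffOn : ContMDiffOn 𝓘(ℝ, E) 𝓘(ℝ, ℝ) 2 r U
  neg_iff : ∀ x ∈ U, r x < 0 ↔ x ∈ Ω
  zero_iff : ∀ x ∈ U, r x = 0 ↔ x ∈ frontier Ω
  d_ne_zero : ∀ x ∈ frontier Ω, dAt (E := E) r x ≠ 0

/-- `Ω` has `C²` boundary and is Levi pseudoconvex: the Levi form `∂∂̄ρ(Z, conj Z)` of its `C²`
defining functions is non-negative on the `(1,0)`-vectors `Z` tangent to the boundary.  (Levi
forms of different defining functions differ by a positive factor.) -/
def IsLeviPseudoconvex (E : Type*) [NormedAddCommGroup E] [NormedSpace ℂ E]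
    {M : Type*} [TopologicalSpace M] [ChartedSpace E M] (Ω : Set M) : Prop :=
  (∃ (U : Set M) (ρ : M → ℝ), IsDefiningFunction (E := E) Ω U ρ) ∧
    ∀ (U : Set M) (ρ : M → ℝ), IsDefiningFunction (E := E) Ω U ρ →
      ∀ p ∈ frontier Ω, ∀ v : TangentSpace 𝓘(ℝ, E) p,
        delAt ρ p v = 0 → 0 ≤ (complexHessian ρ p v v).re

/-- An admissible defining function: `|dr|` is of class `C²` on `U`. -/
def IsAdmissible [IsManifold 𝓘(ℂ, E) ω M] (g : HermitianMetric E M) (Ω U : Set M) (r : M → ℝ) :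
    Prop :=
  IsDefiningFunction (E := E) Ω U r ∧ ContMDiffOn 𝓘(ℝ, E) 𝓘(ℝ, ℝ) 2 (g.normD r) U

end Domains

section Forms

variable {E : Type*} [NormedAddCommGroup E] [NormedSpace ℂ E]
  {M : Type*} [TopologicalSpace M] [ChartedSpace E M]
  {F : Type*} [NormedAddCommGroup F] [NormedSpace ℂ F]
  {S : Type*} [TopologicalSpace S] [ChartedSpace F S]

/-- The pullback of a `1`-form by `ι : S → M`. -/
def OneForm.pullback (β : OneForm E M) (ι : S → M) : OneForm F S := fun q ↦
  (β (ι q)).comp (mfderiv 𝓘(ℝ, F) 𝓘(ℝ, E) ι q : TangentSpace 𝓘(ℝ, F) q →ₗ[ℝ] _)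

/-- The coefficient of the `1`-form `β` in the chart `φ` in the direction `v`: the value at `x` in
the target of `φ` of the pullback of `β` by `φ.symm` on the constant vector field `v`. -/
def OneForm.coeff (β : OneForm F S) (φ : OpenPartialHomeomorph S F) (v : F) (x : F) : ℝ :=
  β (φ.symm x) (mfderiv 𝓘(ℝ, F) 𝓘(ℝ, F) φ.symm x v)

/-- `β` is a continuous `1`-form which is closed in the weak sense: in every smooth chart its
coefficients `β_v` are continuous and `∂_v β_w - ∂_w β_v = 0` in the sense of distributions. -/
def OneForm.IsWeaklyClosed [FiniteDimensional ℂ F] [MeasurableSpace F] [BorelSpace F]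
    (β : OneForm F S) : Prop :=
  ∀ φ ∈ IsManifold.maximalAtlas 𝓘(ℝ, F) ∞ S,
    (∀ v : F, ContinuousOn (β.coeff φ v) φ.target) ∧
    ∀ (v w : F) (χ : F → ℝ), ContDiff ℝ ∞ χ → HasCompactSupport χ → tsupport χ ⊆ φ.target →
      ∫ x, (β.coeff φ v x * fderiv ℝ χ x w - β.coeff φ w x * fderiv ℝ χ x v)
        ∂(MeasureTheory.Measure.addHaar : MeasureTheory.Measure F) = 0

/-- `β` is locally exact: near every point it is the differential of a real `C¹` function. -/
def OneForm.IsLocallyExact (β : OneForm F S) : Prop :=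
  ∀ q : S, ∃ V : Set S, IsOpen V ∧ q ∈ V ∧ ∃ u : S → ℝ,
    ContMDiffOn 𝓘(ℝ, F) 𝓘(ℝ, ℝ) 1 u V ∧ ∀ y ∈ V, β y = dAt u y

end Forms

end DAngelo

end

/-!
Near a point of `S` there are holomorphic charts in which the inclusion is a complex linear map `j`,
so that `r` becomes a function on an open subset of `E` which vanishes on the image of `j`, with
non-negative Levi form on `r = 0`.  Local exactness is proved in such a chart; weak closedness
follows from it, as a distributional statement that is local (`IsLocallyExact.isWeaklyClosed`).

*Reduction to an argument function.*  A vector tangent to `S` is a null vector of the Levi form,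
which is non-negative on the complex tangent space of the boundary, hence it is orthogonal to that
space for the Levi form (`LeviNonneg.polar_eq_zero`).  Therefore `L_r` may be replaced in the
definition of `α_r` by any vector `L` with `∂r(L) = 1`; that `∂r(L_r) = 1` is `dAt_L`.
With a constant vector `e` transversal to the boundary, `P = dr(e)`, `Q = dr(i e)` and the argument
`θ = arctan (-Q / P)`, the choice `L = e / ∂r(e)` gives
`α_r = d (½ log (P² + Q²)) - dθ ∘ J` along `S`.  So it remains to find `u` with `du = -dθ ∘ J`; this
is carried out in `exists_primitive_of_leviNonneg`.

*Pseudoconvexity makes `θ` pluriharmonic.*  The function `θ` is only `C¹`.  The boundary is a graph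
`u = τ (x, s)` over the slice `j x + (u + i s) e`, with `τ (x, 0) = 0` because the boundary contains
`S`, and `θ = arctan (∂τ/∂s (·, 0))`.  The Levi inequality for this graph vanishes identically for
`s = 0`.  As it holds for `s > 0` and for `s < 0`, its first order term in `s` vanishes as well, in
the sense of distributions, and this term expresses that `θ` is weakly pluriharmonic
(`integral_fderiv_mul_fderiv_arctan_eq_zero`).

*Conjugate function.*  Mollification of `θ` and the Poincaré lemma then give `u`
(`exists_hasFDerivAt_conjugate`).
-/

noncomputable section

namespace DAngelo

/-! ### Conjugates of weakly pluriharmonic functions -/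

section WeakHarmonic

open MeasureTheory Metric Filter Function ContinuousLinearMap
open scoped Convolution

variable {F : Type*} [NormedAddCommGroup F] [NormedSpace ℝ F]

/-- Polarization: a symmetric form `B` with `B(v, v) + B(Jv, Jv) = 0` for all `v` is
`J`-anti-invariant. -/
theorem add_comp_eq_zero_of_diagonal {B : F →L[ℝ] F →L[ℝ] ℝ} {J : F →L[ℝ] F}
    (hB : ∀ v w, B v w = B w v) (h : ∀ v, B v v + B (J v) (J v) = 0) (v w : F) :
    B v w + B (J v) (J w) = 0 := by
  have h1 := h (v + w)
  have h2 := h v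
  have h3 := h w
  simp only [map_add, add_apply] at h1
  rw [hB w v, hB (J w) (J v)] at h1
  linarith

/-- On a ball, a uniform limit of exact `1`-forms is exact. -/
theorem exists_hasFDerivAt_of_tendstoUniformlyOn {β : ℕ → F → F →L[ℝ] ℝ} {β' : F → F →L[ℝ] ℝ}
    {x₀ : F} {R : ℝ}
    (h : ∀ n, ∃ u : F → ℝ, ∀ x ∈ ball x₀ R, HasFDerivAt u (β n x) x)
    (hβ : TendstoUniformlyOn β β' atTop (ball x₀ R)) :
    ∃ u : F → ℝ, ∀ x ∈ ball x₀ R, HasFDerivAt u (β' x) x := by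
  choose u hu using h
  let f : ℕ → F → ℝ := fun n x ↦ u n x - u n x₀
  have hf : ∀ n, ∀ x ∈ ball x₀ R, HasFDerivAt (f n) (β n x) x := fun n x hx ↦
    (hu n x hx).sub_const _
  have h0 : Cauchy (map (fun n ↦ f n x₀) atTop) := by
    have : (fun n ↦ f n x₀) = fun _ ↦ (0 : ℝ) := by ext n; simp [f]
    rw [this]
    exact (tendsto_const_nhds (x := (0 : ℝ))).cauchy_map
  have hC := uniformCauchySeqOn_ball_of_fderiv (𝕜 := ℝ) hβ.uniformCauchySeqOn hf h0
  have hlim : ∀ x ∈ ball x₀ R, ∃ y, Tendsto (fun n ↦ f n x) atTop (𝓝 y) := fun x hx ↦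
    cauchy_map_iff_exists_tendsto.1 (hC.cauchy_map hx)
  choose! g hg using hlim
  exact ⟨g, fun x hx ↦ hasFDerivAt_of_tendstoUniformlyOn isOpen_ball hβ hf hg hx⟩

variable [FiniteDimensional ℝ F] [MeasurableSpace F] [BorelSpace F]
  {μ : Measure F} [μ.IsAddHaarMeasure]

/-- A compactly supported `C¹` function `θ` which is weakly pluriharmonic on a ball, i.e. harmonic
in the sense of distributions along each complex line spanned by `v` and `J v`, has a conjugate
function `u` on the concentric ball of half the radius: `du = -dθ ∘ J`.  The mollifications of `θ`
are pluriharmonic in the usual sense, so that the forms `-dθ_n ∘ J` are closed, hence exact, and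
they converge uniformly to `-dθ ∘ J`. -/
theorem exists_hasFDerivAt_conjugate {J : F →L[ℝ] F} (hJ : ∀ v, J (J v) = -v) {θ : F → ℝ}
    (hθ : ContDiff ℝ 1 θ) (hθc : HasCompactSupport θ) {x₀ : F} {R : ℝ} (hR : 0 < R)
    (hw : ∀ χ : F → ℝ, ContDiff ℝ ∞ χ → HasCompactSupport χ → (∀ x, 0 ≤ χ x) →
      tsupport χ ⊆ ball x₀ R → ∀ v, ∫ x, (fderiv ℝ χ x v * fderiv ℝ θ x v +
        fderiv ℝ χ x (J v) * fderiv ℝ θ x (J v)) ∂μ = 0) :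
    ∃ u : F → ℝ, ∀ x ∈ ball x₀ (R / 2), HasFDerivAt u (-(fderiv ℝ θ x).comp J) x := by
  have hn : ∀ n : ℕ, (0 : ℝ) < n + 1 := fun n ↦ by positivity
  let φ : ℕ → ContDiffBump (0 : F) := fun n ↦ ⟨R / 4 / (n + 1), R / 2 / (n + 1),
    div_pos (by positivity) (hn n), div_lt_div_of_pos_right (by linarith) (hn n)⟩
  have hθ' : Continuous (fderiv ℝ θ) := hθ.continuous_fderiv one_ne_zero
  have hφd : ∀ n, ContDiff ℝ ∞ ((φ n).normed μ) := fun n ↦ (φ n).contDiff_normed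
  have hφc : ∀ n, HasCompactSupport ((φ n).normed μ) := fun n ↦ (φ n).hasCompactSupport_normed
  let T : ℕ → F → F →L[ℝ] ℝ := fun n ↦ (φ n).normed μ ⋆[lsmul ℝ ℝ, μ] fderiv ℝ θ
  have hT : ∀ n x, HasFDerivAt ((φ n).normed μ ⋆[lsmul ℝ ℝ, μ] θ) (T n x) x := fun n x ↦ by
    have := hθc.hasFDerivAt_convolution_right (lsmul ℝ ℝ)
      ((hφd n).continuous.locallyIntegrable (μ := μ)) hθ x
    exact this
  have hTd : ∀ n, Differentiable ℝ (T n) := fun n ↦ by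
    have h1 : ContDiff ℝ ∞ ((φ n).normed μ ⋆[lsmul ℝ ℝ, μ] θ) :=
      (hφc n).contDiff_convolution_left (lsmul ℝ ℝ) (hφd n)
        (hθ.continuous.locallyIntegrable (μ := μ))
    have h2 : T n = fderiv ℝ ((φ n).normed μ ⋆[lsmul ℝ ℝ, μ] θ) :=
      funext fun x ↦ (hT n x).fderiv.symm
    rw [h2]
    exact (h1.fderiv_right (m := 1) (by norm_cast)).differentiable one_ne_zero
  let T' : ℕ → F → F →L[ℝ] F →L[ℝ] ℝ := fun n x ↦ fderiv ℝ (T n) x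
  have hT' : ∀ n x, HasFDerivAt (T n) (T' n x) x := fun n x ↦ (hTd n x).hasFDerivAt
  have hsymm : ∀ n x v w, T' n x v w = T' n x w v := fun n x v w ↦
    second_derivative_symmetric (hT n) (hT' n x) v w
  have hφ' : ∀ n, Continuous (fderiv ℝ ((φ n).normed μ)) := fun n ↦
    (hφd n).continuous_fderiv (by simp)
  have hint : ∀ n x v w, Integrable
      (fun t ↦ fderiv ℝ ((φ n).normed μ) (x - t) v * fderiv ℝ θ t w) μ := fun n x v w ↦ by
    have := hφ' n
    refine Continuous.integrable_of_hasCompactSupport (by fun_prop) ?_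
    exact (hθc.fderiv ℝ).mono fun t ht ↦ by
      contrapose! ht
      simp only [mem_support, not_not] at ht ⊢
      simp [ht]
  have hval : ∀ n x v w, T' n x v w =
      ∫ t, fderiv ℝ ((φ n).normed μ) (x - t) v * fderiv ℝ θ t w ∂μ := fun n x v w ↦ by
    have h1 : HasFDerivAt (fun y ↦ T n y w) ((T' n x).flip w) x := by
      simpa using! (hT' n x).clm_apply (hasFDerivAt_const w x)
    have h2 : (fun y ↦ T n y w) = (φ n).normed μ ⋆[lsmul ℝ ℝ, μ] fun t ↦ fderiv ℝ θ t w := by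
      ext y
      change (∫ t, (φ n).normed μ t • fderiv ℝ θ (y - t) ∂μ) w = _
      rw [ContinuousLinearMap.integral_apply]
      · rfl
      · have := (hφd n).continuous
        exact Continuous.integrable_of_hasCompactSupport (by fun_prop) (hφc n).smul_right
    have h3 := (hφc n).hasFDerivAt_convolution_left (lsmul ℝ ℝ) ((hφd n).of_le (by norm_cast))
      ((hθ'.clm_apply (continuous_const (y := w))).locallyIntegrable (μ := μ)) x
    rw [← h2] at h3
    have h4 := congrArg (fun f : F →L[ℝ] ℝ ↦ f v) (h1.unique h3)
    simp only [flip_apply] at h4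
    rw [h4, convolution_eq_swap, ContinuousLinearMap.integral_apply]
    · rfl
    · have := hφ' n
      refine Continuous.integrable_of_hasCompactSupport ?_ ?_
      · exact ((ContinuousLinearMap.precompL F (lsmul ℝ ℝ)).continuous.comp
          (this.comp (continuous_const.sub continuous_id))).clm_apply
          (hθ'.clm_apply continuous_const)
      · exact (hθc.fderiv ℝ).mono fun t ht ↦ by
          contrapose! ht
          simp only [mem_support, not_not] at ht ⊢
          simp [ht]
  have hdiag : ∀ n, ∀ x ∈ ball x₀ (R / 2), ∀ v, T' n x v v + T' n x (J v) (J v) = 0 := by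
    intro n x hx v
    have hd : ∀ t v, fderiv ℝ (fun y ↦ (φ n).normed μ (x - y)) t v =
        -fderiv ℝ ((φ n).normed μ) (x - t) v := fun t v ↦ by
      have h1 : HasFDerivAt (fun y ↦ x - y) (-ContinuousLinearMap.id ℝ F) t := by
        simpa using (hasFDerivAt_id t).const_sub x
      have h2 : HasFDerivAt ((φ n).normed μ) _ (x - t) :=
        (((hφd n).differentiable (by simp)) (x - t)).hasFDerivAt
      have := (h2.comp t h1).fderiv
      change fderiv ℝ ((φ n).normed μ ∘ fun y ↦ x - y) t v = _
      rw [this]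
      simp
    have hsupp : tsupport (fun y ↦ (φ n).normed μ (x - y)) ⊆ closedBall x (R / 2) := by
      refine closure_minimal (fun y hy ↦ ?_) isClosed_closedBall
      have h1 : x - y ∈ ball (0 : F) (R / 2 / (n + 1)) := by
        rw [← (φ n).support_normed_eq (μ := μ)]
        exact hy
      rw [mem_ball_zero_iff, ← dist_eq_norm, dist_comm] at h1
      refine h1.le.trans (div_le_self (by positivity) ?_)
      have : (0 : ℝ) ≤ n := n.cast_nonneg
      linarith
    have := hw (fun y ↦ (φ n).normed μ (x - y)) ((hφd n).comp (contDiff_const.sub contDiff_id))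
      (HasCompactSupport.of_support_subset_isCompact (isCompact_closedBall x (R / 2))
        (subset_closure.trans hsupp))
      (fun y ↦ (φ n).nonneg_normed _) (hsupp.trans ?_) v
    · rw [hval, hval, ← integral_add]
      · simp only [hd] at this
        rw [← neg_eq_zero, ← integral_neg, ← this]
        congr 1
        ext t
        ring
      · exact hint n x v v
      · exact hint n x (J v) (J v)
    · intro y hy
      rw [mem_closedBall] at hy
      rw [mem_ball] at hx ⊢
      linarith [dist_triangle y x x₀]
  refine exists_hasFDerivAt_of_tendstoUniformlyOn (β := fun n x ↦ -(T n x).comp J)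
    (fun n ↦ ?_) ?_
  · have hder : ∀ x, HasFDerivAt (fun x ↦ -(T n x).comp J)
        (-((ContinuousLinearMap.compL ℝ F F ℝ).flip J ∘L T' n x)) x := fun x ↦
      (((ContinuousLinearMap.compL ℝ F F ℝ).flip J).hasFDerivAt.comp x (hT' n x)).neg
    refine (convex_ball x₀ (R / 2)).exists_forall_hasFDerivAt_of_fderiv_symmetric isOpen_ball
      (fun x _ ↦ (hder x).differentiableAt.differentiableWithinAt) fun x hx a b ↦ ?_
    rw [(hder x).fderiv]
    have h1 := add_comp_eq_zero_of_diagonal (hsymm n x) (hdiag n x hx) a (J b)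
    rw [hJ, map_neg] at h1
    have h2 := hsymm n x (J a) b
    simp only [neg_apply, ContinuousLinearMap.comp_apply,
      ContinuousLinearMap.flip_apply, ContinuousLinearMap.compL_apply]
    linarith
  · rw [Metric.tendstoUniformlyOn_iff]
    intro ε hε
    obtain ⟨δ, hδ, hδ'⟩ := Metric.uniformContinuous_iff.1
      ((hθc.fderiv ℝ).uniformContinuous_of_continuous hθ') (ε / (‖J‖ + 1)) (by positivity)
    have hlim : Tendsto (fun n : ℕ ↦ R / 2 / ((n : ℝ) + 1)) atTop (𝓝 0) := by
      simpa [div_eq_mul_inv] using (tendsto_one_div_add_atTop_nhds_zero_nat (𝕜 := ℝ)).const_mul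
        (R / 2)
    filter_upwards [hlim.eventually (gt_mem_nhds hδ)] with n hn x _
    have h1 : dist (T n x) (fderiv ℝ θ x) ≤ ε / (‖J‖ + 1) :=
      (φ n).dist_normed_convolution_le hθ'.aestronglyMeasurable fun y hy ↦
        (hδ' ((mem_ball.1 hy).trans hn)).le
    rw [dist_comm, dist_eq_norm]
    have h2 : -(T n x).comp J - -(fderiv ℝ θ x).comp J = -((T n x - fderiv ℝ θ x).comp J) := by
      ext; simp; ring
    rw [h2, norm_neg]
    calc _ ≤ ‖T n x - fderiv ℝ θ x‖ * ‖J‖ := opNorm_comp_le _ _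
      _ ≤ ε / (‖J‖ + 1) * ‖J‖ := by rw [← dist_eq_norm]; gcongr
      _ < ε := by
        rw [div_mul_eq_mul_div, div_lt_iff₀ (by positivity)]
        nlinarith

end WeakHarmonic

/-! ### The Levi inequality along a graph, divided by the distance to the submanifold -/

section Limit

open MeasureTheory Metric Filter Function ContinuousLinearMap

variable {F : Type*} [NormedAddCommGroup F] [NormedSpace ℝ F]

theorem hasFDerivAt_arctan_fderiv {τ : F × ℝ → ℝ} (hτ : ContDiff ℝ 2 τ) (x : F) :
    HasFDerivAt (fun x ↦ Real.arctan (fderiv ℝ τ (x, 0) (0, 1)))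
      ((1 / (1 + (fderiv ℝ τ (x, 0) (0, 1)) ^ 2)) •
        ((fderiv ℝ (fderiv ℝ τ) (x, 0)).flip (0, 1)).comp (ContinuousLinearMap.inl ℝ F ℝ)) x := by
  have h1 : Differentiable ℝ (fderiv ℝ τ) :=
    (hτ.fderiv_right (m := 1) le_rfl).differentiable one_ne_zero
  have h2 : HasFDerivAt (fun x : F ↦ (x, (0 : ℝ))) (ContinuousLinearMap.inl ℝ F ℝ) x :=
    (hasFDerivAt_id x).prodMk (hasFDerivAt_const _ _)
  have h3 := ((h1 (x, 0)).hasFDerivAt.comp x h2).clm_apply (hasFDerivAt_const ((0 : F), (1 : ℝ)) x)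
  convert! h3.arctan using 1
  ext v
  simp

/-- Hadamard's lemma: if `τ` vanishes for `s = 0`, then its derivative in a direction `(v, 0)` is
`s` times a continuous function, whose value at `s = 0` is the mixed second derivative. -/
theorem exists_continuous_mul_eq_fderiv {τ : F × ℝ → ℝ} (hτ : ContDiff ℝ 2 τ)
    (hτ0 : ∀ x, τ (x, 0) = 0) (v : F) :
    ∃ σ : F × ℝ → ℝ, Continuous σ ∧ (∀ p, fderiv ℝ τ p (v, 0) = p.2 * σ p) ∧
      ∀ x, σ (x, 0) = fderiv ℝ (fderiv ℝ τ) (x, 0) (v, 0) (0, 1) := by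
  have h1 : ContDiff ℝ 1 (fderiv ℝ τ) := hτ.fderiv_right (m := 1) le_rfl
  have h2 : Continuous (fderiv ℝ (fderiv ℝ τ)) := h1.continuous_fderiv one_ne_zero
  refine ⟨fun p ↦ ∫ l in (0 : ℝ)..1, fderiv ℝ (fderiv ℝ τ) (p.1, l * p.2) (0, 1) (v, 0), ?_, ?_, ?_⟩
  · apply intervalIntegral.continuous_parametric_intervalIntegral_of_continuous'
    fun_prop
  · intro p
    have h0 : fderiv ℝ τ (p.1, 0) (v, 0) = 0 := by
      have h3 : HasFDerivAt (fun x : F ↦ (x, (0 : ℝ))) (ContinuousLinearMap.inl ℝ F ℝ) p.1 :=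
        (hasFDerivAt_id p.1).prodMk (hasFDerivAt_const _ _)
      have h4 := ((hτ.differentiable two_ne_zero) (p.1, 0)).hasFDerivAt.comp p.1 h3
      have h5 : τ ∘ (fun x : F ↦ (x, (0 : ℝ))) = fun _ ↦ 0 := funext hτ0
      rw [h5] at h4
      simpa using (congrArg (fun f : F →L[ℝ] ℝ ↦ f v) (h4.unique (hasFDerivAt_const _ _)))
    have h3 : ∀ l : ℝ, HasDerivAt (fun l ↦ fderiv ℝ τ (p.1, l * p.2) (v, 0))
        (p.2 * fderiv ℝ (fderiv ℝ τ) (p.1, l * p.2) (0, 1) (v, 0)) l := fun l ↦ by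
      have h6 : HasDerivAt (fun l : ℝ ↦ (p.1, l * p.2)) ((0 : F), p.2) l := by
        simpa using (hasDerivAt_const l p.1).prodMk ((hasDerivAt_id l).mul_const p.2)
      have h7 := ((h1.differentiable one_ne_zero _).hasFDerivAt.comp_hasDerivAt l h6).clm_apply
        (hasDerivAt_const l (v, (0 : ℝ)))
      have h8 : ((0 : F), p.2) = p.2 • ((0 : F), (1 : ℝ)) := by simp
      rw [h8, map_smul] at h7
      simpa using h7
    have h4 := intervalIntegral.integral_eq_sub_of_hasDerivAt (a := 0) (b := 1) (fun l _ ↦ h3 l)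
      (Continuous.intervalIntegrable (by fun_prop) _ _)
    rw [intervalIntegral.integral_const_mul] at h4
    simp only [one_mul, zero_mul, h0, sub_zero] at h4
    exact h4.symm
  · intro x
    simp only [mul_zero, intervalIntegral.integral_const, sub_zero, one_smul]
    exact (hτ.contDiffAt.isSymmSndFDerivAt (by simp)).eq _ _

variable [FiniteDimensional ℝ F] [MeasurableSpace F] [BorelSpace F]
  {μ : Measure F} [μ.IsAddHaarMeasure]

/-- Integration by parts in the variable `x`, for fixed `s`. -/
theorem integral_mul_fderiv_fderiv_eq {τ : F × ℝ → ℝ} (hτ : ContDiff ℝ 2 τ) {g : F → ℝ}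
    (hg : ContDiff ℝ 1 g) (hgc : HasCompactSupport g) (s : ℝ) (v : F) :
    ∫ x, g x * fderiv ℝ (fderiv ℝ τ) (x, s) (v, 0) (v, 0) ∂μ =
      - ∫ x, fderiv ℝ g x v * fderiv ℝ τ (x, s) (v, 0) ∂μ := by
  have h1 : ContDiff ℝ 1 (fderiv ℝ τ) := hτ.fderiv_right (m := 1) le_rfl
  have h2 : Continuous (fderiv ℝ (fderiv ℝ τ)) := h1.continuous_fderiv one_ne_zero
  have h3 : ∀ x, HasFDerivAt (fun x ↦ fderiv ℝ τ (x, s) (v, 0))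
      (((fderiv ℝ (fderiv ℝ τ) (x, s)).flip (v, 0)).comp (ContinuousLinearMap.inl ℝ F ℝ)) x := by
    intro x
    have h4 : HasFDerivAt (fun x : F ↦ (x, s)) (ContinuousLinearMap.inl ℝ F ℝ) x :=
      (hasFDerivAt_id x).prodMk (hasFDerivAt_const _ _)
    have h5 := ((h1.differentiable one_ne_zero (x, s)).hasFDerivAt.comp x h4).clm_apply
      (hasFDerivAt_const (v, (0 : ℝ)) x)
    convert! h5 using 1
    ext w
    simp
  have h4 : ∀ x, fderiv ℝ (fun x ↦ fderiv ℝ τ (x, s) (v, 0)) x v =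
      fderiv ℝ (fderiv ℝ τ) (x, s) (v, 0) (v, 0) := fun x ↦ by rw [(h3 x).fderiv]; simp
  have hg' := hg.continuous_fderiv one_ne_zero
  have := hg.continuous
  have h5 := integral_mul_fderiv_eq_neg_fderiv_mul_of_integrable (μ := μ) (f := g)
    (g := fun x ↦ fderiv ℝ τ (x, s) (v, 0)) (v := v) ?_ ?_ ?_
    (fun x _ ↦ hg.differentiable one_ne_zero x) (fun x _ ↦ (h3 x).differentiableAt)
  · simpa only [h4] using h5
  · exact Continuous.integrable_of_hasCompactSupport (by fun_prop)
      ((hgc.fderiv_apply ℝ v).mul_right)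
  · simp only [h4]
    exact Continuous.integrable_of_hasCompactSupport (by fun_prop) hgc.mul_right
  · exact Continuous.integrable_of_hasCompactSupport (by fun_prop) hgc.mul_right

/-- Let `τ` vanish for `s = 0` and let the hypersurface `u = τ (x, s)` satisfy, over `s` and for
`|t| < δ`, the Levi inequality in the tangent directions lying over `v` and `w`; here `w` stands
for `i v`.  Then
`arctan (∂τ/∂s (·, 0))` is harmonic along `v`, `w` in the sense of distributions.

The Levi inequality is multiplied by the weight `χ / (1 + (∂τ/∂s)²)` and integrated.  After an
integration by parts every term contains a factor `t`: the integral equals `t ∫ B (x, t)` with `B`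
continuous.  It is non-positive, so division by `t > 0` and by `t < 0` and the limit `t → 0` give
`∫ B (x, 0) = 0`, and `B (x, 0)` is the negative of the integrand below. -/
theorem integral_fderiv_mul_fderiv_arctan_eq_zero {τ : F × ℝ → ℝ} (hτ : ContDiff ℝ 2 τ)
    (hτ0 : ∀ x, τ (x, 0) = 0) {s : Set F} {δ : ℝ} (hδ : 0 < δ) {v w : F}
    (hQ : ∀ x ∈ s, ∀ t, |t| < δ → ∀ a b : ℝ,
      a = fderiv ℝ τ (x, t) (v, b) → -b = fderiv ℝ τ (x, t) (w, a) →
      fderiv ℝ (fderiv ℝ τ) (x, t) (v, b) (v, b) +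
        fderiv ℝ (fderiv ℝ τ) (x, t) (w, a) (w, a) ≤ 0)
    {χ : F → ℝ} (hχ : ContDiff ℝ 1 χ) (hχc : HasCompactSupport χ) (hχ0 : ∀ x, 0 ≤ χ x)
    (hχs : tsupport χ ⊆ s) :
    ∫ x, (fderiv ℝ χ x v * fderiv ℝ (fun x ↦ Real.arctan (fderiv ℝ τ (x, 0) (0, 1))) x v +
      fderiv ℝ χ x w * fderiv ℝ (fun x ↦ Real.arctan (fderiv ℝ τ (x, 0) (0, 1))) x w) ∂μ = 0 := by
  have hT : ContDiff ℝ 1 (fderiv ℝ τ) := hτ.fderiv_right (m := 1) le_rfl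
  have hTc : Continuous (fderiv ℝ τ) := hT.continuous
  have hT2 : Continuous (fderiv ℝ (fderiv ℝ τ)) := hT.continuous_fderiv one_ne_zero
  have hχ' := hχ.continuous_fderiv one_ne_zero
  have hχ'' := hχ.continuous
  obtain ⟨σ, hσc, hσ, hσ0⟩ := exists_continuous_mul_eq_fderiv hτ hτ0 v
  obtain ⟨ρ, hρc, hρ, hρ0⟩ := exists_continuous_mul_eq_fderiv hτ hτ0 w
  -- `k = ∂τ/∂s`, and `m v` is the mixed second derivative
  let k : F × ℝ → ℝ := fun p ↦ fderiv ℝ τ p (0, 1)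
  let m : F → F × ℝ → ℝ := fun v p ↦ fderiv ℝ (fderiv ℝ τ) p (v, 0) (0, 1)
  have hD : ∀ p, 1 + k p ^ 2 ≠ 0 := fun p ↦ by positivity
  have hkc : Continuous k := by fun_prop
  have hmc : ∀ v, Continuous (m v) := fun v ↦ by fun_prop
  -- `dg v` is the derivative in the direction `v` of the weight `χ / (1 + k²)`
  let dg : F → F × ℝ → ℝ := fun v p ↦
    fderiv ℝ χ p.1 v / (1 + k p ^ 2) - 2 * k p * χ p.1 * m v p / (1 + k p ^ 2) ^ 2
  -- `(v, s b)` and `(w, s a)` span the complex tangent line over `v`, `w`: by definition of `σ` and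
  -- `ρ` the two tangency equations are `a = σ + k b` and `-b = ρ + k a`
  let a : F × ℝ → ℝ := fun p ↦ (σ p - k p * ρ p) / (1 + k p ^ 2)
  let b : F × ℝ → ℝ := fun p ↦ -(ρ p + k p * σ p) / (1 + k p ^ 2)
  have hac : Continuous a := by
    exact (hσc.sub (hkc.mul hρc)).div (by fun_prop) hD
  have hbc : Continuous b := by
    exact (hρc.add (hkc.mul hσc)).neg.div (by fun_prop) hD
  have hdgc : ∀ v, Continuous (dg v) := fun v ↦ by
    have := hmc v
    exact ((by fun_prop : Continuous fun p : F × ℝ ↦ fderiv ℝ χ p.1 v).div (by fun_prop) hD).sub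
      ((by fun_prop : Continuous fun p : F × ℝ ↦ 2 * k p * χ p.1 * m v p).div (by fun_prop)
        fun p ↦ pow_ne_zero _ (hD p))
  have hgc : Continuous fun p : F × ℝ ↦ χ p.1 / (1 + k p ^ 2) :=
    (by fun_prop : Continuous fun p : F × ℝ ↦ χ p.1).div (by fun_prop) hD
  -- by the tangency equations `t * B₂` collects the terms of the Levi inequality other than
  -- `τ''((v, 0), (v, 0)) + τ''((w, 0), (w, 0))`
  let B₂ : F × ℝ → ℝ := fun p ↦ 2 * b p * m v p + 2 * a p * m w p +
    p.2 * (a p ^ 2 + b p ^ 2) * fderiv ℝ (fderiv ℝ τ) p (0, 1) (0, 1)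
  have hB₂c : Continuous B₂ := by
    have := hmc v
    have := hmc w
    fun_prop
  let B : F × ℝ → ℝ := fun p ↦ -(dg v p * σ p) - dg w p * ρ p + χ p.1 / (1 + k p ^ 2) * B₂ p
  have hBc : Continuous B :=
    (((hdgc v).mul hσc).neg.sub ((hdgc w).mul hρc)).add (hgc.mul hB₂c)
  have hχz : ∀ x, x ∉ tsupport χ → χ x = 0 := fun x hx ↦ image_eq_zero_of_notMem_tsupport hx
  have hχz' : ∀ x, x ∉ tsupport χ → fderiv ℝ χ x = 0 := fun x hx ↦
    image_eq_zero_of_notMem_tsupport fun h ↦ hx (tsupport_fderiv_subset ℝ h)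
  have hdgz : ∀ v x t, x ∉ tsupport χ → dg v (x, t) = 0 := fun v x t hx ↦ by
    simp [dg, hχz x hx, hχz' x hx]
  have hBz : ∀ x t, x ∉ tsupport χ → B (x, t) = 0 := fun x t hx ↦ by
    simp [B, hdgz _ x t hx, hχz x hx]
  have hIc : Continuous fun t ↦ ∫ x, B (x, t) ∂μ := by
    have h1 : ∀ t, ∫ x, B (x, t) ∂μ = ∫ x in tsupport χ, B (x, t) ∂μ := fun t ↦
      (setIntegral_eq_integral_of_forall_compl_eq_zero fun x hx ↦ hBz x t hx).symm
    simp only [h1]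
    exact continuous_parametric_integral_of_continuous (f := fun t x ↦ B (x, t))
      (hBc.comp continuous_swap) hχc
  -- integration by parts moves one derivative from `τ` to the weight
  have hparts : ∀ t v, Integrable (fun x ↦ χ x / (1 + k (x, t) ^ 2) *
      fderiv ℝ (fderiv ℝ τ) (x, t) (v, 0) (v, 0)) μ ∧
      ∫ x, χ x / (1 + k (x, t) ^ 2) * fderiv ℝ (fderiv ℝ τ) (x, t) (v, 0) (v, 0) ∂μ =
      - ∫ x, dg v (x, t) * fderiv ℝ τ (x, t) (v, 0) ∂μ := fun t v ↦ by
    have hk1 : ContDiff ℝ 1 fun x ↦ k (x, t) :=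
      (hT.comp (contDiff_id.prodMk contDiff_const)).clm_apply contDiff_const
    have hg1 : ContDiff ℝ 1 fun x ↦ χ x / (1 + k (x, t) ^ 2) :=
      hχ.div (contDiff_const.add (hk1.pow 2)) fun x ↦ hD _
    have hsupp : HasCompactSupport fun x ↦ χ x / (1 + k (x, t) ^ 2) := by
      simp only [div_eq_mul_inv]
      exact hχc.mul_right
    refine ⟨Continuous.integrable_of_hasCompactSupport ?_ hsupp.mul_right, ?_⟩
    · have := hg1.continuous
      fun_prop
    rw [integral_mul_fderiv_fderiv_eq hτ hg1 hsupp t v]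
    congr 2 with x
    congr 1
    have hkd : HasFDerivAt (fun x ↦ k (x, t))
        (((fderiv ℝ (fderiv ℝ τ) (x, t)).flip (0, 1)).comp (ContinuousLinearMap.inl ℝ F ℝ)) x := by
      have h4 : HasFDerivAt (fun x : F ↦ (x, t)) (ContinuousLinearMap.inl ℝ F ℝ) x :=
        (hasFDerivAt_id x).prodMk (hasFDerivAt_const _ _)
      have h5 := ((hT.differentiable one_ne_zero (x, t)).hasFDerivAt.comp x h4).clm_apply
        (hasFDerivAt_const ((0 : F), (1 : ℝ)) x)
      convert! h5 using 1
      ext w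
      simp
    have h6 := (hχ.differentiable one_ne_zero x).hasFDerivAt.mul
      ((hasDerivAt_inv (hD (x, t))).comp_hasFDerivAt x ((hkd.pow 2).const_add 1))
    have h7 : fderiv ℝ (fun x ↦ χ x / (1 + k (x, t) ^ 2)) x v = _ :=
      congrArg (fun f : F →L[ℝ] ℝ ↦ f v) h6.fderiv
    rw [h7]
    simp only [dg, m, Function.comp_apply, add_apply, smul_apply, ContinuousLinearMap.comp_apply,
      flip_apply, inl_apply, smul_eq_mul]
    have := hD (x, t)
    field_simp
    simp only [nsmul_eq_mul]
    push_cast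
    ring
  -- the weighted integral of the Levi inequality
  have hneg : ∀ t, |t| < δ → t * ∫ x, B (x, t) ∂μ ≤ 0 := by
    intro t ht
    have hi : ∀ v, Integrable (fun x ↦ dg v (x, t) * fderiv ℝ τ (x, t) (v, 0)) μ := fun v ↦ by
      have := hdgc v
      refine Continuous.integrable_of_hasCompactSupport (by fun_prop)
        (HasCompactSupport.intro hχc fun x hx ↦ ?_)
      rw [hdgz v x t hx, zero_mul]
    have hi2 : Integrable (fun x ↦ t * (χ x / (1 + k (x, t) ^ 2) * B₂ (x, t))) μ := by
      refine Continuous.integrable_of_hasCompactSupport ?_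
        (HasCompactSupport.intro hχc fun x hx ↦ ?_)
      · exact continuous_const.mul ((hgc.mul hB₂c).comp (by fun_prop : Continuous fun x ↦ (x, t)))
      · simp [hχz x hx]
    have h1 : t * ∫ x, B (x, t) ∂μ = ∫ x, χ x / (1 + k (x, t) ^ 2) *
        (fderiv ℝ (fderiv ℝ τ) (x, t) (v, 0) (v, 0) +
          fderiv ℝ (fderiv ℝ τ) (x, t) (w, 0) (w, 0) + t * B₂ (x, t)) ∂μ := by
      have h2 : ∀ x, t * B (x, t) = -(dg v (x, t) * fderiv ℝ τ (x, t) (v, 0)) -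
          dg w (x, t) * fderiv ℝ τ (x, t) (w, 0) + t * (χ x / (1 + k (x, t) ^ 2) * B₂ (x, t)) :=
        fun x ↦ by rw [hσ, hρ]; simp only [B]; ring
      have h3 : ∀ x, χ x / (1 + k (x, t) ^ 2) *
        (fderiv ℝ (fderiv ℝ τ) (x, t) (v, 0) (v, 0) +
          fderiv ℝ (fderiv ℝ τ) (x, t) (w, 0) (w, 0) + t * B₂ (x, t)) =
          χ x / (1 + k (x, t) ^ 2) * fderiv ℝ (fderiv ℝ τ) (x, t) (v, 0) (v, 0) +
          χ x / (1 + k (x, t) ^ 2) * fderiv ℝ (fderiv ℝ τ) (x, t) (w, 0) (w, 0) +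
          t * (χ x / (1 + k (x, t) ^ 2) * B₂ (x, t)) := fun x ↦ by ring
      rw [← integral_const_mul]
      simp only [h2, h3]
      have h4 : Integrable (fun x ↦ -(dg v (x, t) * fderiv ℝ τ (x, t) (v, 0))) μ := (hi v).neg
      have h5 : Integrable (fun x ↦ -(dg v (x, t) * fderiv ℝ τ (x, t) (v, 0)) -
          dg w (x, t) * fderiv ℝ τ (x, t) (w, 0)) μ := h4.sub (hi w)
      have h6 : Integrable (fun x ↦
          χ x / (1 + k (x, t) ^ 2) * fderiv ℝ (fderiv ℝ τ) (x, t) (v, 0) (v, 0) +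
          χ x / (1 + k (x, t) ^ 2) * fderiv ℝ (fderiv ℝ τ) (x, t) (w, 0) (w, 0)) μ :=
        (hparts t v).1.add (hparts t w).1
      rw [integral_add h5 hi2, integral_add h6 hi2, integral_sub h4 (hi w),
        integral_add (hparts t v).1 (hparts t w).1, (hparts t v).2, (hparts t w).2, integral_neg]
      ring
    rw [h1]
    refine integral_nonpos fun x ↦ ?_
    by_cases hx : x ∈ tsupport χ
    · refine mul_nonpos_of_nonneg_of_nonpos (div_nonneg (hχ0 x) (by positivity)) ?_
      have hpair : ∀ (v : F) (c : ℝ), (v, c) = (v, (0 : ℝ)) + c • ((0 : F), (1 : ℝ)) :=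
        fun v c ↦ by simp
      have hsymm : ∀ v, fderiv ℝ (fderiv ℝ τ) (x, t) (0, 1) (v, 0) = m v (x, t) := fun v ↦
        (hτ.contDiffAt.isSymmSndFDerivAt (by simp)).eq _ _
      have hq := hQ x (hχs hx) t ht (t * a (x, t)) (t * b (x, t)) ?_ ?_
      · rw [hpair v, hpair w] at hq
        simp only [map_add, map_smul, add_apply, smul_apply, smul_eq_mul, hsymm] at hq
        refine le_of_eq_of_le ?_ hq
        simp only [B₂, m]
        ring
      · rw [hpair v, map_add, map_smul, hσ, smul_eq_mul]
        change _ = _ + _ * k (x, t)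
        have := hD (x, t)
        simp only [a, b]
        field_simp
        ring
      · rw [hpair w, map_add, map_smul, hρ, smul_eq_mul]
        change _ = _ + _ * k (x, t)
        have := hD (x, t)
        simp only [a, b]
        field_simp
        ring
    · simp [hχz x hx]
  -- division by `t`, and the limits `t → 0` from the right and from the left
  have hzero : ∫ x, B (x, 0) ∂μ = 0 := by
    apply le_antisymm
    · refine le_of_tendsto (hIc.continuousAt.tendsto.mono_left nhdsWithin_le_nhds : Tendsto _
        (𝓝[>] (0 : ℝ)) _) ?_
      filter_upwards [Ioo_mem_nhdsGT hδ] with t ht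
      have := hneg t (by rw [abs_of_pos ht.1]; exact ht.2)
      exact nonpos_of_mul_nonpos_right this ht.1
    · refine ge_of_tendsto (hIc.continuousAt.tendsto.mono_left nhdsWithin_le_nhds : Tendsto _
        (𝓝[<] (0 : ℝ)) _) ?_
      filter_upwards [Ioo_mem_nhdsLT (neg_lt_zero.2 hδ)] with t ht
      have := hneg t (by rw [abs_of_neg ht.2]; linarith [ht.1])
      exact nonneg_of_mul_nonpos_right this ht.2
  rw [← neg_eq_zero, ← integral_neg]
  refine (integral_congr_ae (Eventually.of_forall fun x ↦ ?_)).trans hzero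
  have h1 : ∀ v, fderiv ℝ (fun x ↦ Real.arctan (fderiv ℝ τ (x, 0) (0, 1))) x v =
      m v (x, 0) / (1 + k (x, 0) ^ 2) := fun v ↦ by
    rw [(hasFDerivAt_arctan_fderiv hτ x).fderiv]
    simp [m, k, div_eq_inv_mul]
  have h2 : σ (x, 0) = m v (x, 0) := hσ0 x
  have h3 : ρ (x, 0) = m w (x, 0) := hρ0 x
  have := hD (x, 0)
  rw [h1, h1]
  simp only [B, B₂, dg, a, b, h2, h3]
  field_simp
  ring

end Limit

/-! ### Second derivatives and the Levi form -/

section SecondDerivative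

open MeasureTheory Metric Filter Function ContinuousLinearMap

variable {G E : Type*} [NormedAddCommGroup G] [NormedSpace ℝ G]
  [NormedAddCommGroup E] [NormedSpace ℝ E]

theorem eventually_differentiableAt_of_contDiffAt {E' : Type*} [NormedAddCommGroup E']
    [NormedSpace ℝ E'] {f : G → E'} {p : G} (hf : ContDiffAt ℝ 2 f p) :
    ∀ᶠ q in 𝓝 p, DifferentiableAt ℝ f q :=
  (hf.eventually (by simp)).mono fun _ h ↦ h.differentiableAt two_ne_zero

theorem differentiableAt_fderiv_of_contDiffAt {E' : Type*} [NormedAddCommGroup E']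
    [NormedSpace ℝ E'] {f : G → E'} {p : G} (hf : ContDiffAt ℝ 2 f p) :
    DifferentiableAt ℝ (fderiv ℝ f) p :=
  (hf.fderiv_right (m := 1) le_rfl).differentiableAt one_ne_zero

theorem fderiv_fderiv_comp_apply {r : E → ℝ} {γ : G → E} {p : G} (hr : ContDiffAt ℝ 2 r (γ p))
    (hγ : ContDiffAt ℝ 2 γ p) (v w : G) :
    fderiv ℝ (fderiv ℝ (r ∘ γ)) p v w =
      fderiv ℝ (fderiv ℝ r) (γ p) (fderiv ℝ γ p v) (fderiv ℝ γ p w) +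
        fderiv ℝ r (γ p) (fderiv ℝ (fderiv ℝ γ) p v w) := by
  have h1 : fderiv ℝ (r ∘ γ) =ᶠ[𝓝 p] fun q ↦ (fderiv ℝ r (γ q)).comp (fderiv ℝ γ q) := by
    filter_upwards [eventually_differentiableAt_of_contDiffAt hγ,
      hγ.continuousAt.eventually (eventually_differentiableAt_of_contDiffAt hr)] with q h2 h3
    exact fderiv_comp q h3 h2
  have h2 : HasFDerivAt (fun q ↦ fderiv ℝ r (γ q))
      ((fderiv ℝ (fderiv ℝ r) (γ p)).comp (fderiv ℝ γ p)) p :=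
    (differentiableAt_fderiv_of_contDiffAt hr).hasFDerivAt.comp p
      (hγ.differentiableAt two_ne_zero).hasFDerivAt
  have h3 : HasFDerivAt (fun q ↦ fderiv ℝ γ q) (fderiv ℝ (fderiv ℝ γ) p) p :=
    (differentiableAt_fderiv_of_contDiffAt hγ).hasFDerivAt
  rw [h1.fderiv_eq, (h2.clm_comp h3).fderiv]
  simp
  ring

theorem fderiv_fderiv_clm (A : G →L[ℝ] E) (p : G) : fderiv ℝ (fderiv ℝ A) p = 0 := by
  have : fderiv ℝ A = fun _ ↦ A := by ext1 q; exact A.fderiv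
  rw [this, fderiv_fun_const]
  rfl

end SecondDerivative

section Levi

open MeasureTheory Metric Filter Function ContinuousLinearMap

variable {E : Type*} [NormedAddCommGroup E] [NormedSpace ℂ E]

/-- `r` has a non-negative Levi form at its zero `y`. -/
def LeviNonneg (r : E → ℝ) (y : E) : Prop :=
  ∀ v : E, fderiv ℝ r y v = 0 → fderiv ℝ r y (Complex.I • v) = 0 →
    0 ≤ fderiv ℝ (fderiv ℝ r) y v v + fderiv ℝ (fderiv ℝ r) y (Complex.I • v) (Complex.I • v)

/-- A null vector of a non-negative hermitian form lies in its kernel (Cauchy–Schwarz). -/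
theorem LeviNonneg.polar_eq_zero {r : E → ℝ} {y : E} (h : LeviNonneg r y)
    (hr : ContDiffAt ℝ 2 r y) {v w : E} (hv : fderiv ℝ r y v = 0)
    (hv' : fderiv ℝ r y (Complex.I • v) = 0) (hw : fderiv ℝ r y w = 0)
    (hw' : fderiv ℝ r y (Complex.I • w) = 0)
    (h0 : fderiv ℝ (fderiv ℝ r) y v v +
      fderiv ℝ (fderiv ℝ r) y (Complex.I • v) (Complex.I • v) = 0) :
    fderiv ℝ (fderiv ℝ r) y v w +
      fderiv ℝ (fderiv ℝ r) y (Complex.I • v) (Complex.I • w) = 0 := by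
  have hs : ∀ a b, fderiv ℝ (fderiv ℝ r) y a b = fderiv ℝ (fderiv ℝ r) y b a := fun a b ↦
    (hr.isSymmSndFDerivAt (by simp)).eq a b
  set H := fderiv ℝ (fderiv ℝ r) y
  set B := H v w + H (Complex.I • v) (Complex.I • w) with hB
  set C := H w w + H (Complex.I • w) (Complex.I • w) with hC
  have key : ∀ t : ℝ, 0 ≤ C + 2 * t * B := fun t ↦ by
    have h1 := h (w + t • v) (by simp [hv, hw])
      (by rw [smul_add, smul_comm]; simp [hv', hw'])
    rw [smul_add, smul_comm Complex.I t v] at h1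
    simp only [map_add, map_smul, add_apply, smul_apply, smul_eq_mul] at h1
    rw [hs w v, hs (Complex.I • w) (Complex.I • v)] at h1
    linear_combination h1 + t ^ 2 * h0
  by_contra hne
  have h2 := key (-(C + 1) / (2 * B))
  have h3 : 2 * (-(C + 1) / (2 * B)) * B = -(C + 1) := by field_simp
  rw [h3] at h2
  linarith

end Levi

section Graph

open MeasureTheory Metric Filter Function ContinuousLinearMap

variable {E F : Type*} [NormedAddCommGroup E] [NormedSpace ℂ E]
  [NormedAddCommGroup F] [NormedSpace ℂ F]

/-- The real-linear map `((x, s), u) ↦ j x + s • i e + u • e`. -/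
def sliceMap (j : F →L[ℂ] E) (e : E) : (F × ℝ) × ℝ →L[ℝ] E :=
  (((j.restrictScalars ℝ).coprod ((ContinuousLinearMap.id ℝ ℝ).smulRight (Complex.I • e))).coprod
    ((ContinuousLinearMap.id ℝ ℝ).smulRight e))

@[simp]
theorem sliceMap_apply (j : F →L[ℂ] E) (e : E) (p : (F × ℝ) × ℝ) :
    sliceMap j e p = j p.1.1 + p.1.2 • Complex.I • e + p.2 • e := by
  simp [sliceMap]

/-- The defining function of the zero set of `r`, written as a graph `u = τ (x, s)` over the slice
`j x + (u + i s) e`, inherits the Levi condition. -/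
theorem LeviNonneg.graph {j : F →L[ℂ] E} {e : E} {r : E → ℝ} {τ : F × ℝ → ℝ} {p : F × ℝ}
    (hτ : ContDiffAt ℝ 2 τ p) (hr : ContDiffAt ℝ 2 r (sliceMap j e (p, τ p)))
    (hL : LeviNonneg r (sliceMap j e (p, τ p)))
    (h0 : ∀ᶠ q in 𝓝 p, r (sliceMap j e (q, τ q)) = 0)
    (he : 0 < fderiv ℝ r (sliceMap j e (p, τ p)) e) {v : F} {a b : ℝ}
    (ha : a = fderiv ℝ τ p (v, b)) (hb : -b = fderiv ℝ τ p (Complex.I • v, a)) :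
    fderiv ℝ (fderiv ℝ τ) p (v, b) (v, b) +
      fderiv ℝ (fderiv ℝ τ) p (Complex.I • v, a) (Complex.I • v, a) ≤ 0 := by
  let γ : F × ℝ → E := fun q ↦ sliceMap j e (q, τ q)
  have hγ : ContDiffAt ℝ 2 γ p :=
    (sliceMap j e).contDiff.contDiffAt.comp p (contDiffAt_id.prodMk hτ)
  have hd : ∀ᶠ q in 𝓝 p, fderiv ℝ γ q = (sliceMap j e).comp
      ((ContinuousLinearMap.id ℝ (F × ℝ)).prod (fderiv ℝ τ q)) := by
    filter_upwards [eventually_differentiableAt_of_contDiffAt hτ] with q hq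
    exact ((sliceMap j e).hasFDerivAt.comp q ((hasFDerivAt_id q).prodMk hq.hasFDerivAt)).fderiv
  have hd1 : ∀ w c, fderiv ℝ γ p (w, c) = j w + c • Complex.I • e + fderiv ℝ τ p (w, c) • e :=
    fun w c ↦ by rw [hd.self_of_nhds]; simp
  have hd2 : ∀ ξ ζ, fderiv ℝ (fderiv ℝ γ) p ξ ζ = fderiv ℝ (fderiv ℝ τ) p ξ ζ • e := by
    intro ξ ζ
    have h1 : HasFDerivAt (fun q ↦ fderiv ℝ γ q ζ) ((fderiv ℝ (fderiv ℝ γ) p).flip ζ) p := by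
      simpa using! (differentiableAt_fderiv_of_contDiffAt hγ).hasFDerivAt.clm_apply
        (hasFDerivAt_const ζ p)
    have h2 : HasFDerivAt (fun q ↦ fderiv ℝ τ q ζ) ((fderiv ℝ (fderiv ℝ τ) p).flip ζ) p := by
      simpa using! (differentiableAt_fderiv_of_contDiffAt hτ).hasFDerivAt.clm_apply
        (hasFDerivAt_const ζ p)
    have h3 : (fun q ↦ fderiv ℝ γ q ζ) =ᶠ[𝓝 p]
        fun q ↦ (j ζ.1 + ζ.2 • Complex.I • e) + fderiv ℝ τ q ζ • e := by
      filter_upwards [hd] with q hq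
      rw [hq]; simp
    have h4 := (h1.congr_of_eventuallyEq h3.symm).unique
      ((h2.smul_const e).const_add (j ζ.1 + ζ.2 • Complex.I • e))
    simpa using congrArg (fun f : F × ℝ →L[ℝ] E ↦ f ξ) h4
  have hz : r ∘ γ =ᶠ[𝓝 p] fun _ ↦ 0 := h0
  have hz1 : ∀ ξ, fderiv ℝ r (γ p) (fderiv ℝ γ p ξ) = 0 := fun ξ ↦ by
    have h1 := fderiv_comp p (hr.differentiableAt two_ne_zero) (hγ.differentiableAt two_ne_zero)
    rw [hz.fderiv_eq, fderiv_fun_const] at h1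
    exact (congrArg (fun f : F × ℝ →L[ℝ] ℝ ↦ f ξ) h1).symm
  -- the second derivative of the identity `r ∘ γ = 0`
  have hz2 : ∀ ξ, fderiv ℝ (fderiv ℝ r) (γ p) (fderiv ℝ γ p ξ) (fderiv ℝ γ p ξ) +
      fderiv ℝ r (γ p) e * fderiv ℝ (fderiv ℝ τ) p ξ ξ = 0 := fun ξ ↦ by
    have h1 := fderiv_fderiv_comp_apply (γ := γ) hr hγ ξ ξ
    have h2 : fderiv ℝ (r ∘ γ) =ᶠ[𝓝 p] fun _ ↦ 0 := by
      have := hz.fderiv (𝕜 := ℝ)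
      simpa using! this
    rw [h2.fderiv_eq, fderiv_fun_const, hd2, map_smul, smul_eq_mul] at h1
    rw [mul_comm]
    exact h1.symm
  -- `ha` and `hb` say that the tangent vector over `(v, b)` is a complex tangent vector
  have hI : fderiv ℝ γ p (Complex.I • v, a) = Complex.I • fderiv ℝ γ p (v, b) := by
    rw [hd1, hd1, ← ha, ← hb, smul_add, smul_add, map_smul, smul_comm Complex.I b,
      smul_comm Complex.I a, smul_smul Complex.I Complex.I, Complex.I_mul_I]
    module
  have h1 := hL (fderiv ℝ γ p (v, b)) (hz1 _) (by rw [← hI]; exact hz1 _)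
  have h2 := hz2 (v, b)
  have h3 := hz2 (Complex.I • v, a)
  rw [hI] at h3
  have h4 : fderiv ℝ r (γ p) e * (fderiv ℝ (fderiv ℝ τ) p (v, b) (v, b) +
      fderiv ℝ (fderiv ℝ τ) p (Complex.I • v, a) (Complex.I • v, a)) ≤ 0 := by
    rw [mul_add]
    linarith
  exact nonpos_of_mul_nonpos_right h4 he

end Graph

/-! ### A primitive of D'Angelo's form in a chart -/

section FlatPrimitive

open MeasureTheory Metric Filter Function ContinuousLinearMap

variable {E F : Type*} [NormedAddCommGroup E] [NormedSpace ℂ E]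
  [NormedAddCommGroup F] [NormedSpace ℂ F]

theorem contDiffAt_one_of_hasFDerivAt {F : Type*} [NormedAddCommGroup F] [NormedSpace ℝ F]
    {u : F → ℝ} {u' : F → F →L[ℝ] ℝ} {s : Set F} (hs : IsOpen s)
    (hu : ∀ x ∈ s, HasFDerivAt u (u' x) x)
    (hc : ContinuousOn u' s) {x : F} (hx : x ∈ s) : ContDiffAt ℝ 1 u x :=
  contDiffAt_one_iff.2 ⟨u', s, hs.mem_nhds hx, hc, hu⟩

/-- Multiplication by `i` as a real-linear map. -/
def mulI (F : Type*) [NormedAddCommGroup F] [NormedSpace ℂ F] : F →L[ℝ] F :=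
  (Complex.I • ContinuousLinearMap.id ℂ F).restrictScalars ℝ

@[simp]
theorem mulI_apply (v : F) : mulI F v = Complex.I • v := rfl

variable [FiniteDimensional ℂ F]

/-- Near a point of a complex subspace contained in the zero set of `r`, the zero set is a graph
`u = τ (x, s)` over the slice `j x + (u + i s) e`, and `τ (x, 0) = 0`.  A cut-off makes `τ` global
and compactly supported. -/
theorem exists_graph {j : F →L[ℂ] E} {e : E} {r : E → ℝ} {x₀ : F} (hr : ContDiffAt ℝ 2 r (j x₀))
    (h0 : ∀ᶠ x in 𝓝 x₀, r (j x) = 0) (he : fderiv ℝ r (j x₀) e ≠ 0) :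
    ∃ τ : F × ℝ → ℝ, ContDiff ℝ 2 τ ∧ HasCompactSupport τ ∧ (∀ x, τ (x, 0) = 0) ∧
      ∀ᶠ q in 𝓝 (x₀, (0 : ℝ)), r (sliceMap j e (q, τ q)) = 0 := by
  have hA : sliceMap j e ((x₀, 0), 0) = j x₀ := by simp
  have hΦ : ContDiffAt ℝ 2 (r ∘ sliceMap j e) ((x₀, 0), 0) :=
    ContDiffAt.comp _ (by rwa [hA]) (sliceMap j e).contDiff.contDiffAt
  have hΦd : fderiv ℝ (r ∘ sliceMap j e) ((x₀, 0), 0) =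
      (fderiv ℝ r (j x₀)).comp (sliceMap j e) := by
    have h1 : DifferentiableAt ℝ r (sliceMap j e ((x₀, 0), 0)) := by
      rw [hA]; exact hr.differentiableAt two_ne_zero
    rw [fderiv_comp _ h1 (sliceMap j e).differentiableAt, hA, ContinuousLinearMap.fderiv]
  have hinv : (fderiv ℝ (r ∘ sliceMap j e) ((x₀, 0), 0) ∘L .inr ℝ (F × ℝ) ℝ).IsInvertible := by
    refine ⟨ContinuousLinearEquiv.unitsEquivAut ℝ (Units.mk0 _ he), ?_⟩
    ext
    simp [hΦd]
  let ψ := hΦ.implicitFunction two_ne_zero hinv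
  have hψ : ContDiffAt ℝ 2 ψ (x₀, 0) := hΦ.contDiffAt_implicitFunction two_ne_zero hinv
  have hr0 : (r ∘ sliceMap j e) ((x₀, 0), 0) = 0 := by
    rw [comp_apply, hA]; exact h0.self_of_nhds
  have hψ0 : ∀ᶠ q in 𝓝 (x₀, (0 : ℝ)), r (sliceMap j e (q, ψ q)) = 0 := by
    have := hΦ.eventually_apply_implicitFunction two_ne_zero hinv
    rwa [hr0] at this
  have hψz : ∀ᶠ x in 𝓝 x₀, ψ (x, 0) = 0 := by
    have h1 := hΦ.eventually_apply_eq_iff_implicitFunction two_ne_zero hinv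
    rw [hr0] at h1
    have h2 : Tendsto (fun x : F ↦ ((x, (0 : ℝ)), (0 : ℝ))) (𝓝 x₀) (𝓝 ((x₀, 0), 0)) :=
      (by fun_prop : Continuous fun x : F ↦ ((x, (0 : ℝ)), (0 : ℝ))).tendsto x₀
    filter_upwards [h2.eventually h1, h0] with x h3 h4
    exact h3.1 (by simpa using h4)
  have hev : ∀ᶠ q : F × ℝ in 𝓝 (x₀, 0), ContDiffAt ℝ 2 ψ q ∧ ψ (q.1, 0) = 0 :=
    (hψ.eventually (by simp)).and ((continuous_fst.tendsto (x₀, (0 : ℝ))).eventually hψz)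
  obtain ⟨R, hR, hball⟩ := Metric.eventually_nhds_iff_ball.1 hev
  have : FiniteDimensional ℝ F := FiniteDimensional.complexToReal F
  let κ : ContDiffBump (x₀, (0 : ℝ)) := ⟨R / 4, R / 2, by positivity, by linarith⟩
  have hsub : tsupport κ ⊆ ball (x₀, (0 : ℝ)) R := by
    rw [κ.tsupport_eq]
    exact closedBall_subset_ball (by change R / 2 < R; linarith)
  refine ⟨fun q ↦ κ q * ψ q, ?_, κ.hasCompactSupport.mul_right, fun x ↦ ?_, ?_⟩
  · refine contDiff_iff_contDiffAt.2 fun q ↦ ?_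
    by_cases hq : q ∈ tsupport κ
    · exact κ.contDiff.contDiffAt.mul (hball q (hsub hq)).1
    · refine (contDiffAt_const (c := (0 : ℝ))).congr_of_eventuallyEq ?_
      filter_upwards [(isClosed_tsupport κ).isOpen_compl.mem_nhds hq] with q' hq'
      rw [image_eq_zero_of_notMem_tsupport hq', zero_mul]
  · by_cases hx : (x, (0 : ℝ)) ∈ tsupport κ
    · simp only [(hball _ (hsub hx)).2, mul_zero]
    · simp only [image_eq_zero_of_notMem_tsupport hx, zero_mul]
  · filter_upwards [hψ0, κ.eventuallyEq_one] with q h1 h2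
    simpa only [h2, Pi.one_apply, one_mul] using h1

/-- If a complex subspace lies in a pseudoconvex hypersurface `r = 0`, then the argument `θ` of
`∂r(e)` along the subspace is weakly pluriharmonic and therefore has a conjugate function. -/
theorem exists_conjugate_of_leviNonneg {j : F →L[ℂ] E} {e : E} {r : E → ℝ} {x₀ : F}
    (hr : ContDiffAt ℝ 2 r (j x₀)) (h0 : ∀ᶠ x in 𝓝 x₀, r (j x) = 0)
    (hL : ∀ᶠ y in 𝓝 (j x₀), r y = 0 → LeviNonneg r y) (he : 0 < fderiv ℝ r (j x₀) e) :
    ∃ θ u : F → ℝ, ContDiff ℝ 1 θ ∧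
      (∀ᶠ x in 𝓝 x₀, θ x =
        Real.arctan (-(fderiv ℝ r (j x) (Complex.I • e) / fderiv ℝ r (j x) e))) ∧
      ∀ᶠ x in 𝓝 x₀, HasFDerivAt u (-(fderiv ℝ θ x).comp (mulI F)) x := by
  have : FiniteDimensional ℝ F := FiniteDimensional.complexToReal F
  let _ : MeasurableSpace F := borel F
  have : BorelSpace F := ⟨rfl⟩
  obtain ⟨τ, hτ, hτc, hτ0, hτr⟩ := exists_graph hr h0 he.ne'
  have htend : Tendsto (fun q ↦ sliceMap j e (q, τ q)) (𝓝 (x₀, 0)) (𝓝 (j x₀)) := by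
    have h1 : Continuous fun q ↦ sliceMap j e (q, τ q) :=
      (sliceMap j e).continuous.comp (continuous_id.prodMk hτ.continuous)
    have h2 := h1.tendsto (x₀, 0)
    simpa [hτ0] using h2
  have hepos : ∀ᶠ y in 𝓝 (j x₀), 0 < fderiv ℝ r y e :=
    ((differentiableAt_fderiv_of_contDiffAt hr).continuousAt.clm_apply
      continuousAt_const).eventually (lt_mem_nhds he)
  have hev : ∀ᶠ q in 𝓝 (x₀, (0 : ℝ)), (∀ᶠ q' in 𝓝 q, r (sliceMap j e (q', τ q')) = 0) ∧
      ContDiffAt ℝ 2 r (sliceMap j e (q, τ q)) ∧ LeviNonneg r (sliceMap j e (q, τ q)) ∧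
      0 < fderiv ℝ r (sliceMap j e (q, τ q)) e := by
    filter_upwards [hτr.eventually_nhds, htend.eventually (hr.eventually (by simp)),
      htend.eventually hL, htend.eventually hepos] with q h1 h2 h3 h4
    exact ⟨h1, h2, h3 h1.self_of_nhds, h4⟩
  obtain ⟨R, hR, hball⟩ := Metric.eventually_nhds_iff_ball.1 hev
  have hmem : ∀ x ∈ ball x₀ R, ∀ t : ℝ, |t| < R → (x, t) ∈ ball (x₀, (0 : ℝ)) R := by
    intro x hx t ht
    rw [mem_ball, Prod.dist_eq, max_lt_iff]
    exact ⟨hx, by simpa using ht⟩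
  let θ : F → ℝ := fun x ↦ Real.arctan (fderiv ℝ τ (x, 0) (0, 1))
  have hθ : ContDiff ℝ 1 θ := by
    have h1 : ContDiff ℝ 1 (fderiv ℝ τ) := hτ.fderiv_right (m := 1) le_rfl
    exact Real.contDiff_arctan.comp
      ((h1.comp (contDiff_id.prodMk contDiff_const)).clm_apply contDiff_const)
  have hθc : HasCompactSupport θ := by
    refine HasCompactSupport.intro ((hτc.fderiv ℝ).image continuous_fst) fun x hx ↦ ?_
    have : fderiv ℝ τ (x, 0) = 0 := image_eq_zero_of_notMem_tsupport fun h ↦ hx ⟨_, h, rfl⟩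
    simp [θ, this]
  obtain ⟨u, hu⟩ := exists_hasFDerivAt_conjugate (J := mulI F) (μ := Measure.addHaar)
    (fun v ↦ by simp [smul_smul]) hθ hθc hR fun χ h1 h2 h3 h4 v ↦
    integral_fderiv_mul_fderiv_arctan_eq_zero hτ hτ0 hR (fun x hx t ht a b ha hb ↦ by
      obtain ⟨k1, k2, k3, k4⟩ := hball _ (hmem x hx t ht)
      exact LeviNonneg.graph hτ.contDiffAt k2 k3 k1 k4 ha hb)
      (h1.of_le (by norm_cast)) h2 h3 h4
  refine ⟨θ, u, hθ, ?_, ?_⟩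
  · filter_upwards [ball_mem_nhds x₀ hR] with x hx
    obtain ⟨k1, k2, -, k4⟩ := hball _ (hmem x hx 0 (by simpa using hR))
    simp only [θ]
    congr 1
    have hd : HasFDerivAt (fun q ↦ sliceMap j e (q, τ q)) ((sliceMap j e).comp
        ((ContinuousLinearMap.id ℝ (F × ℝ)).prod (fderiv ℝ τ (x, 0)))) (x, 0) :=
      (sliceMap j e).hasFDerivAt.comp _
        ((hasFDerivAt_id _).prodMk (hτ.differentiable two_ne_zero _).hasFDerivAt)
    have h1 := ((k2.differentiableAt two_ne_zero).hasFDerivAt.comp (x, (0 : ℝ)) hd).unique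
      ((hasFDerivAt_const (0 : ℝ) (x, (0 : ℝ))).congr_of_eventuallyEq k1)
    have h2 := congrArg (fun f : F × ℝ →L[ℝ] ℝ ↦ f (0, 1)) h1
    simp only [ContinuousLinearMap.comp_apply, ContinuousLinearMap.prod_apply, id_apply,
      sliceMap_apply, map_zero, zero_add, one_smul, map_add, map_smul, smul_eq_mul,
      hτ0, zero_smul, add_zero, zero_apply] at h2 k4
    field_simp
    linarith
  · filter_upwards [ball_mem_nhds x₀ (half_pos hR)] with x hx using hu x hx

/-- Near a point of a complex subspace contained in the zero set of `r`, the form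
`v ↦ α_r(v)` is exact along the subspace. Here `L` is any vector with `∂r(L) = 1`. -/
theorem exists_primitive_of_leviNonneg {j : F →L[ℂ] E} {r : E → ℝ} {x₀ : F}
    (hr : ContDiffAt ℝ 2 r (j x₀)) (h0 : ∀ᶠ x in 𝓝 x₀, r (j x) = 0)
    (hL : ∀ᶠ y in 𝓝 (j x₀), r y = 0 → LeviNonneg r y) (hd : fderiv ℝ r (j x₀) ≠ 0) :
    ∃ U : F → ℝ, ∀ᶠ x in 𝓝 x₀, ContDiffAt ℝ 1 U x ∧ ∀ L : E, fderiv ℝ r (j x) L = 2 →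
      fderiv ℝ r (j x) (Complex.I • L) = 0 → ∀ v : F, fderiv ℝ U x v =
        (1 / 2) * (fderiv ℝ (fderiv ℝ r) (j x) (j v) L +
          fderiv ℝ (fderiv ℝ r) (j x) (Complex.I • j v) (Complex.I • L)) := by
  obtain ⟨e, he⟩ : ∃ e, 0 < fderiv ℝ r (j x₀) e := by
    by_contra! h
    refine hd (ContinuousLinearMap.ext fun v ↦ le_antisymm (h v) ?_)
    have := h (-v)
    rw [map_neg] at this
    simpa using this
  obtain ⟨θ, u, hθ, hθe, hu⟩ := exists_conjugate_of_leviNonneg hr h0 hL he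
  let jr : F →L[ℝ] E := j.restrictScalars ℝ
  have hjt : Tendsto j (𝓝 x₀) (𝓝 (j x₀)) := j.continuous.tendsto x₀
  let P : F → ℝ := fun x ↦ fderiv ℝ r (j x) e
  let Q : F → ℝ := fun x ↦ fderiv ℝ r (j x) (Complex.I • e)
  have hgen : ∀ e', ∀ x, ContDiffAt ℝ 2 r (j x) →
      ContDiffAt ℝ 1 (fun x ↦ fderiv ℝ r (j x) e') x ∧ HasFDerivAt (fun x ↦ fderiv ℝ r (j x) e')
        (((fderiv ℝ (fderiv ℝ r) (j x)).flip e').comp jr) x := by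
    intro e' x hx
    have h1 : ContDiffAt ℝ 1 (fderiv ℝ r) (j x) := hx.fderiv_right (m := 1) le_rfl
    refine ⟨(h1.comp x jr.contDiff.contDiffAt).clm_apply contDiffAt_const, ?_⟩
    have h2 := ((h1.differentiableAt one_ne_zero).hasFDerivAt.comp x jr.hasFDerivAt).clm_apply
      (hasFDerivAt_const e' x)
    convert! h2 using 1
    ext v
    simp
  have hepos : ∀ᶠ y in 𝓝 (j x₀), 0 < fderiv ℝ r y e :=
    ((differentiableAt_fderiv_of_contDiffAt hr).continuousAt.clm_apply
      continuousAt_const).eventually (lt_mem_nhds he)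
  refine ⟨fun x ↦ (1 / 2) * Real.log (P x ^ 2 + Q x ^ 2) + u x, ?_⟩
  filter_upwards [hu.eventually_nhds, hθe.eventually_nhds, hjt.eventually (hr.eventually (by simp)),
    hjt.eventually hepos, hjt.eventually hL, h0.eventually_nhds] with x hux hθx hrx hPx hLx h0x
  have hP := hgen e x hrx
  have hQ := hgen (Complex.I • e) x hrx
  have hPx : 0 < P x := hPx
  have hpos : 0 < P x ^ 2 + Q x ^ 2 := by positivity
  have huc : ContDiffAt ℝ 1 u x := by
    obtain ⟨s, hs, hso, hxs⟩ := _root_.eventually_nhds_iff.1 hux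
    refine contDiffAt_one_of_hasFDerivAt hso hs ?_ hxs
    have := hθ.continuous_fderiv one_ne_zero
    exact ((this.clm_comp continuous_const).neg).continuousOn
  refine ⟨(contDiffAt_const.mul (((hP.1.pow 2).add (hQ.1.pow 2)).log hpos.ne')).add huc, ?_⟩
  intro L hL1 hL2 v
  have hUd : fderiv ℝ (fun x ↦ (1 / 2) * Real.log (P x ^ 2 + Q x ^ 2) + u x) x v =
      (P x * fderiv ℝ (fderiv ℝ r) (j x) (j v) e +
        Q x * fderiv ℝ (fderiv ℝ r) (j x) (j v) (Complex.I • e)) / (P x ^ 2 + Q x ^ 2) -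
      fderiv ℝ θ x (Complex.I • v) := by
    have h1 := (((((hP.2.pow 2).add (hQ.2.pow 2)).log hpos.ne').const_mul (1 / 2)).add
      hux.self_of_nhds).fderiv
    refine (congrArg (fun f : F →L[ℝ] ℝ ↦ f v) h1).trans ?_
    simp only [add_apply, smul_apply, neg_apply, ContinuousLinearMap.comp_apply, flip_apply,
      mulI_apply, smul_eq_mul, nsmul_eq_mul, Pi.add_apply]
    change 1 / 2 * ((P x ^ 2 + Q x ^ 2)⁻¹ * (_ * P x ^ (2 - 1) *
      fderiv ℝ (fderiv ℝ r) (j x) (j v) e + _ * Q x ^ (2 - 1) *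
      fderiv ℝ (fderiv ℝ r) (j x) (j v) (Complex.I • e))) + _ = _
    field_simp
    push_cast
    ring
  have hθd : ∀ w, fderiv ℝ θ x w = (Q x * fderiv ℝ (fderiv ℝ r) (j x) (j w) e -
      P x * fderiv ℝ (fderiv ℝ r) (j x) (j w) (Complex.I • e)) / (P x ^ 2 + Q x ^ 2) := fun w ↦ by
    have h1 : HasFDerivAt θ _ x :=
      ((hQ.2.mul ((hasDerivAt_inv hPx.ne').comp_hasFDerivAt x
        hP.2)).neg.arctan).congr_of_eventuallyEq hθx
    rw [h1.fderiv]
    simp only [add_apply, smul_apply, neg_apply, ContinuousLinearMap.comp_apply, flip_apply,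
      smul_eq_mul, Pi.neg_apply, Pi.mul_apply, Function.comp_apply]
    change 1 / (1 + (-(Q x * (P x)⁻¹)) ^ 2) * -(Q x * (_ * fderiv ℝ (fderiv ℝ r) (j x) (j w) e) +
      _ * fderiv ℝ (fderiv ℝ r) (j x) (j w) (Complex.I • e)) = _
    have := hPx.ne'
    have : P x ^ 2 + (-Q x) ^ 2 ≠ 0 := by rw [neg_sq]; exact hpos.ne'
    field_simp
    ring
  have hz : r ∘ jr =ᶠ[𝓝 x] fun _ ↦ 0 := h0x
  have hzx : r (j x) = 0 := h0x.self_of_nhds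
  have ht : ∀ w, fderiv ℝ r (j x) (j w) = 0 := fun w ↦ by
    have h1 := ((hrx.differentiableAt two_ne_zero).hasFDerivAt.comp x jr.hasFDerivAt).unique
      ((hasFDerivAt_const (0 : ℝ) x).congr_of_eventuallyEq hz)
    exact congrArg (fun f : F →L[ℝ] ℝ ↦ f w) h1
  have ht2 : ∀ w, fderiv ℝ (fderiv ℝ r) (j x) (j w) (j w) = 0 := fun w ↦ by
    have h1 := fderiv_fderiv_comp_apply (γ := jr) hrx jr.contDiff.contDiffAt w w
    have h2 : fderiv ℝ (r ∘ jr) =ᶠ[𝓝 x] fun _ ↦ 0 := by simpa using! hz.fderiv (𝕜 := ℝ)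
    rw [h2.fderiv_eq, fderiv_fun_const, fderiv_fderiv_clm, ContinuousLinearMap.fderiv] at h1
    simpa using! h1.symm
  have hI : ∀ w : F, Complex.I • j w = j (Complex.I • w) := fun w ↦ (map_smul j _ _).symm
  -- `∂r((a + i b) e) = 1`, so that `L - (a + i b) e` is a complex tangent vector of `r = 0`
  set a := 2 * P x / (P x ^ 2 + Q x ^ 2) with ha
  set b := 2 * Q x / (P x ^ 2 + Q x ^ 2) with hb
  have hII : Complex.I • (a • e + b • Complex.I • e) = a • Complex.I • e - b • e := by
    rw [smul_add, smul_comm Complex.I a, smul_comm Complex.I b, smul_smul Complex.I Complex.I,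
      Complex.I_mul_I]
    module
  have hPe : fderiv ℝ r (j x) e = P x := rfl
  have hQe : fderiv ℝ r (j x) (Complex.I • e) = Q x := rfl
  have hpol := (hLx hzx).polar_eq_zero hrx (v := j v) (w := L - (a • e + b • Complex.I • e)) (ht v)
    (by rw [hI, ht])
    (by
      simp only [map_sub, map_add, map_smul, hL1, hPe, hQe, smul_eq_mul, ha, hb]
      field_simp
      ring)
    (by
      rw [smul_sub, hII]
      simp only [map_sub, map_smul, hL2, hPe, hQe, smul_eq_mul, ha, hb]
      field_simp
      ring)
    (by rw [hI, ht2, ht2, add_zero])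
  rw [smul_sub, hII] at hpol
  simp only [map_sub, map_add, map_smul, smul_eq_mul] at hpol
  rw [hUd, hθd, map_smul j Complex.I v]
  set H := fderiv ℝ (fderiv ℝ r) (j x)
  have e1 : H (j v) L + H (Complex.I • j v) (Complex.I • L) =
      a * (H (j v) e + H (Complex.I • j v) (Complex.I • e)) +
      b * (H (j v) (Complex.I • e) - H (Complex.I • j v) e) := by linear_combination hpol
  rw [e1, ha, hb]
  field_simp
  ring

end FlatPrimitive

/-! ### Locally exact forms are weakly closed -/

section WeaklyClosed

open MeasureTheory Metric Filter Function ContinuousLinearMap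

variable {F : Type*} [NormedAddCommGroup F] [NormedSpace ℝ F] [FiniteDimensional ℝ F]

/-- Locally, a `C¹` function on an open set has the same differential as a global `C¹` function. -/
theorem exists_contDiff_fderiv_eq {u : F → ℝ} {W : Set F} (hW : IsOpen W)
    (hu : ContDiffOn ℝ 1 u W) {x : F} (hx : x ∈ W) :
    ∃ W', IsOpen W' ∧ x ∈ W' ∧ W' ⊆ W ∧ ∃ u' : F → ℝ, ContDiff ℝ 1 u' ∧
      ∀ y ∈ W', fderiv ℝ u' y = fderiv ℝ u y := by
  obtain ⟨R, hR, hball⟩ := Metric.isOpen_iff.1 hW x hx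
  let κ : ContDiffBump x := ⟨R / 4, R / 2, by positivity, by linarith⟩
  have hsub : tsupport κ ⊆ W := by
    rw [κ.tsupport_eq]
    exact (closedBall_subset_ball (by change R / 2 < R; linarith)).trans hball
  refine ⟨ball x (R / 4), isOpen_ball, mem_ball_self (by positivity),
    (ball_subset_ball (by linarith)).trans hball, fun y ↦ κ y * u y, ?_, fun y hy ↦ ?_⟩
  · refine contDiff_iff_contDiffAt.2 fun q ↦ ?_
    by_cases hq : q ∈ tsupport κ
    · exact κ.contDiff.contDiffAt.mul (hu.contDiffAt (hW.mem_nhds (hsub hq)))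
    · refine (contDiffAt_const (c := (0 : ℝ))).congr_of_eventuallyEq ?_
      filter_upwards [(isClosed_tsupport κ).isOpen_compl.mem_nhds hq] with q' hq'
      rw [image_eq_zero_of_notMem_tsupport hq', zero_mul]
  · refine Filter.EventuallyEq.fderiv_eq ?_
    filter_upwards [isOpen_ball.mem_nhds hy] with z hz
    rw [κ.one_of_mem_closedBall (ball_subset_closedBall hz), one_mul]

variable [MeasurableSpace F] [BorelSpace F] {μ : Measure F} [μ.IsAddHaarMeasure]

/-- The differential of a `C¹` function is closed in the sense of distributions. -/
theorem integral_fderiv_mul_fderiv_sub_eq_zero {u χ : F → ℝ} (hu : ContDiff ℝ 1 u)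
    (hχ : ContDiff ℝ ∞ χ) (hχc : HasCompactSupport χ) (v w : F) :
    Integrable (fun x ↦ fderiv ℝ u x v * fderiv ℝ χ x w - fderiv ℝ u x w * fderiv ℝ χ x v) μ ∧
    ∫ x, (fderiv ℝ u x v * fderiv ℝ χ x w - fderiv ℝ u x w * fderiv ℝ χ x v) ∂μ = 0 := by
  have hχ1 : ContDiff ℝ ∞ (fderiv ℝ χ) := hχ.fderiv_right (m := ∞) (by norm_cast)
  have hχw : ∀ w, ContDiff ℝ ∞ fun x ↦ fderiv ℝ χ x w := fun w ↦ hχ1.clm_apply contDiff_const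
  have hu1 := hu.continuous_fderiv one_ne_zero
  have hu0 := hu.continuous
  have hχ1c := hχ1.continuous
  have hχ2c : Continuous (fderiv ℝ (fderiv ℝ χ)) := hχ1.continuous_fderiv (by simp)
  have hd : ∀ w x v, fderiv ℝ (fun x ↦ fderiv ℝ χ x w) x v = fderiv ℝ (fderiv ℝ χ) x v w := by
    intro w x v
    have h1 := ((hχ1.differentiable (by simp) x).hasFDerivAt.clm_apply
      (hasFDerivAt_const w x)).fderiv
    refine (congrArg (fun f : F →L[ℝ] ℝ ↦ f v) h1).trans ?_
    simp
  have hi : ∀ v w, Integrable (fun x ↦ fderiv ℝ u x v * fderiv ℝ χ x w) μ := fun v w ↦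
    Continuous.integrable_of_hasCompactSupport (by fun_prop) (hχc.fderiv_apply ℝ w).mul_left
  have hparts : ∀ v w, ∫ x, u x * fderiv ℝ (fderiv ℝ χ) x v w ∂μ =
      - ∫ x, fderiv ℝ u x v * fderiv ℝ χ x w ∂μ := fun v w ↦ by
    simp only [← hd]
    refine integral_mul_fderiv_eq_neg_fderiv_mul_of_integrable (hi v w) ?_ ?_
      (fun x _ ↦ hu.differentiable one_ne_zero x) (fun x _ ↦ (hχw w).differentiable (by simp) x)
    · simp only [hd]
      refine Continuous.integrable_of_hasCompactSupport (by fun_prop)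
        (HasCompactSupport.intro hχc fun x hx ↦ ?_)
      rw [image_eq_zero_of_notMem_tsupport fun h ↦
        hx (tsupport_fderiv_subset ℝ (tsupport_fderiv_subset ℝ h))]
      simp
    · exact Continuous.integrable_of_hasCompactSupport (by fun_prop)
        (hχc.fderiv_apply ℝ w).mul_left
  refine ⟨(hi v w).sub (hi w v), ?_⟩
  rw [integral_sub (hi v w) (hi w v)]
  have h1 := hparts v w
  have h2 := hparts w v
  have h3 : ∀ x, fderiv ℝ (fderiv ℝ χ) x v w = fderiv ℝ (fderiv ℝ χ) x w v := fun x ↦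
    ((contDiff_infty.1 hχ 2).contDiffAt.isSymmSndFDerivAt (by simp)).eq v w
  simp only [h3] at h1
  linarith

/-- A locally exact form is closed in the sense of distributions.  The property that the integral
vanishes for all test functions supported in an open set is local and passes to unions of two open
sets, by splitting the test function; compactness of the support does the rest. -/
theorem integral_sub_eq_zero_of_locally_exact {a : F → F → ℝ} {O : Set F}
    (h : ∀ x ∈ O, ∃ W, IsOpen W ∧ x ∈ W ∧ ∃ u : F → ℝ, ContDiff ℝ 1 u ∧
      ∀ y ∈ W, ∀ v, a v y = fderiv ℝ u y v)
    {χ : F → ℝ} (hχ : ContDiff ℝ ∞ χ) (hχc : HasCompactSupport χ) (hχO : tsupport χ ⊆ O) (v w : F) :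
    ∫ x, (a v x * fderiv ℝ χ x w - a w x * fderiv ℝ χ x v) ∂μ = 0 := by
  let I : (F → ℝ) → F → ℝ := fun χ x ↦ a v x * fderiv ℝ χ x w - a w x * fderiv ℝ χ x v
  let p : Set F → Prop := fun s ↦ ∃ W, IsOpen W ∧ s ⊆ W ∧ ∀ χ : F → ℝ, ContDiff ℝ ∞ χ →
    HasCompactSupport χ → tsupport χ ⊆ W → Integrable (I χ) μ ∧ ∫ x, I χ x ∂μ = 0
  have hp : p (tsupport χ) := by
    refine IsCompact.induction_on (p := p) hχc ?_ ?_ ?_ ?_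
    · refine ⟨∅, isOpen_empty, subset_rfl, fun χ _ _ h ↦ ?_⟩
      have h0 : χ = 0 := by
        rw [Set.subset_empty_iff, tsupport_eq_empty_iff] at h
        exact h
      have h1 : I χ = fun _ ↦ 0 := by
        ext x
        simp [I, h0]
      rw [h1]
      simp
    · exact fun s t hst ⟨W, hW, htW, h⟩ ↦ ⟨W, hW, hst.trans htW, h⟩
    · rintro s t ⟨W₁, hW₁, hs, h₁⟩ ⟨W₂, hW₂, ht, h₂⟩
      refine ⟨W₁ ∪ W₂, hW₁.union hW₂, Set.union_subset_union hs ht, fun χ hχ hχc hχW ↦ ?_⟩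
      -- a cut-off function splits `χ` into a part supported in `W₁` and a part supported in `W₂`
      have hK : IsClosed (tsupport χ \ W₂) := (isClosed_tsupport χ).sdiff hW₂
      have hKW : tsupport χ \ W₂ ⊆ W₁ := fun x hx ↦ (hχW hx.1).resolve_right hx.2
      obtain ⟨T, hT, hKT, hTW⟩ := normal_exists_closure_subset hK hW₁ hKW
      obtain ⟨ψ, hψ1, hψ0, -⟩ := exists_contMDiffMap_one_nhds_of_subset_interior (n := ⊤)
        𝓘(ℝ, F) hK (t := T) (by rwa [hT.interior_eq])
      have hψ : ContDiff ℝ ∞ ψ := ψ.contMDiff.contDiff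
      have hψt : tsupport ψ ⊆ W₁ := by
        refine (closure_mono fun x hx ↦ ?_).trans hTW
        by_contra hxT
        exact hx (hψ0 x hxT)
      obtain ⟨hi1, hz1⟩ := h₁ (fun x ↦ ψ x * χ x) (hψ.mul hχ) hχc.mul_left
        (tsupport_mul_subset_left.trans hψt)
      obtain ⟨hi2, hz2⟩ := h₂ (fun x ↦ (1 - ψ x) * χ x) ((contDiff_const.sub hψ).mul hχ)
        hχc.mul_left (fun x hx ↦ by
          by_contra hx2
          have hxK : x ∈ tsupport χ \ W₂ := ⟨tsupport_mul_subset_right hx, hx2⟩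
          have h1 : ∀ᶠ y in 𝓝 x, ψ y = 1 := hψ1.filter_mono (nhds_le_nhdsSet hxK)
          refine notMem_tsupport_iff_eventuallyEq.2 ?_ hx
          filter_upwards [h1] with y hy
          simp [hy])
      have hsum : I χ = fun x ↦ I (fun x ↦ ψ x * χ x) x + I (fun x ↦ (1 - ψ x) * χ x) x := by
        ext x
        have h3 : DifferentiableAt ℝ (fun x ↦ ψ x * χ x) x :=
          (hψ.mul hχ).differentiable (by simp) x
        have h4 : DifferentiableAt ℝ (fun x ↦ (1 - ψ x) * χ x) x :=
          ((contDiff_const.sub hψ).mul hχ).differentiable (by simp) x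
        have h5 : χ = (fun x ↦ ψ x * χ x) + fun x ↦ (1 - ψ x) * χ x := by
          ext x
          simp only [Pi.add_apply]
          ring
        have h6 : fderiv ℝ χ x = fderiv ℝ (fun x ↦ ψ x * χ x) x +
            fderiv ℝ (fun x ↦ (1 - ψ x) * χ x) x := by
          conv_lhs => rw [h5]
          exact fderiv_add h3 h4
        simp only [I, h6, add_apply]
        ring
      rw [hsum]
      refine ⟨hi1.add hi2, ?_⟩
      rw [integral_add hi1 hi2, hz1, hz2, add_zero]
    · intro x hx
      obtain ⟨W, hW, hxW, u, hu, hau⟩ := h x (hχO hx)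
      refine ⟨W, mem_nhdsWithin_of_mem_nhds (hW.mem_nhds hxW), W, hW, subset_rfl,
        fun χ hχ hχc hχW ↦ ?_⟩
      have h1 : I χ = fun x ↦
          fderiv ℝ u x v * fderiv ℝ χ x w - fderiv ℝ u x w * fderiv ℝ χ x v := by
        ext y
        by_cases hy : y ∈ tsupport χ
        · simp only [I, hau y (hχW hy)]
        · have h2 : fderiv ℝ χ y = 0 := image_eq_zero_of_notMem_tsupport fun h ↦
            hy (tsupport_fderiv_subset ℝ h)
          simp [I, h2]
      rw [h1]
      exact integral_fderiv_mul_fderiv_sub_eq_zero hu hχ hχc v w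
  obtain ⟨W, -, hW, hI⟩ := hp
  exact (hI χ hχ hχc hW).2

end WeaklyClosed

section Manifold

open MeasureTheory Metric Filter Function ContinuousLinearMap

variable {F : Type*} [NormedAddCommGroup F] [NormedSpace ℂ F]
  {S : Type*} [TopologicalSpace S] [ChartedSpace F S]

theorem dAt_apply (u : S → ℝ) (q : S) (v : TangentSpace 𝓘(ℝ, F) q) :
    dAt u q v = mfderiv 𝓘(ℝ, F) 𝓘(ℝ, ℝ) u q v := rfl

theorem dAt_mfderiv_symm {φ : OpenPartialHomeomorph S F}
    (hφ : φ ∈ IsManifold.maximalAtlas 𝓘(ℝ, F) 1 S) {u : S → ℝ} {y : F} (hy : y ∈ φ.target)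
    (hu : MDifferentiableAt 𝓘(ℝ, F) 𝓘(ℝ, ℝ) u (φ.symm y)) (v : F) :
    dAt u (φ.symm y) (mfderiv 𝓘(ℝ, F) 𝓘(ℝ, F) φ.symm y v) = fderiv ℝ (u ∘ φ.symm) y v := by
  have h1 : MDifferentiableAt 𝓘(ℝ, F) 𝓘(ℝ, F) φ.symm y :=
    ((contMDiffOn_symm_of_mem_maximalAtlas hφ).contMDiffAt
      (φ.open_target.mem_nhds hy)).mdifferentiableAt one_ne_zero
  rw [dAt_apply, ← mfderiv_eq_fderiv, mfderiv_comp y hu h1]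
  rfl

theorem OneForm.IsLocallyExact.isWeaklyClosed [FiniteDimensional ℂ F] [MeasurableSpace F]
    [BorelSpace F] {β : OneForm F S} (hβ : β.IsLocallyExact) : β.IsWeaklyClosed := by
  have : FiniteDimensional ℝ F := FiniteDimensional.complexToReal F
  intro φ hφ
  have hφ1 : φ ∈ IsManifold.maximalAtlas 𝓘(ℝ, F) 1 S :=
    IsManifold.maximalAtlas_subset_of_le (by norm_cast) hφ
  have key : ∀ x ∈ φ.target, ∃ W, IsOpen W ∧ x ∈ W ∧ ∃ u : F → ℝ, ContDiff ℝ 1 u ∧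
      ∀ y ∈ W, ∀ v, β.coeff φ v y = fderiv ℝ u y v := by
    intro x hx
    obtain ⟨V, hV, hqV, u, hu, hβu⟩ := hβ (φ.symm x)
    have hW : IsOpen (φ.target ∩ φ.symm ⁻¹' V) := φ.isOpen_inter_preimage_symm hV
    have hsymm := contMDiffOn_symm_of_mem_maximalAtlas hφ1
    have huW : ContDiffOn ℝ 1 (u ∘ φ.symm) (φ.target ∩ φ.symm ⁻¹' V) :=
      contMDiffOn_iff_contDiffOn.1 (hu.comp (hsymm.mono Set.inter_subset_left)
        Set.inter_subset_right)
    obtain ⟨W', hW', hxW', hWW', u', hu', hd⟩ := exists_contDiff_fderiv_eq hW huW ⟨hx, hqV⟩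
    refine ⟨W', hW', hxW', u', hu', fun y hy v ↦ ?_⟩
    have hyW := hWW' hy
    rw [hd y hy, OneForm.coeff, hβu _ hyW.2]
    exact dAt_mfderiv_symm hφ1 hyW.1
      ((hu.contMDiffAt (hV.mem_nhds hyW.2)).mdifferentiableAt one_ne_zero) v
  refine ⟨fun v x hx ↦ ?_, fun v w χ h1 h2 h3 ↦
    integral_sub_eq_zero_of_locally_exact key h1 h2 h3 v w⟩
  obtain ⟨W, hW, hxW, u, hu, hβu⟩ := key x hx
  have h1 : ContinuousAt (fun y ↦ fderiv ℝ u y v) x :=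
    ((hu.continuous_fderiv one_ne_zero).clm_apply continuous_const).continuousAt
  refine (h1.congr ?_).continuousWithinAt
  filter_upwards [hW.mem_nhds hxW] with y hy using (hβu y hy v).symm

end Manifold

/-! ### The normal field `L_r` -/

section NormalField

open ContinuousLinearMap

variable {E : Type*} [NormedAddCommGroup E] [NormedSpace ℂ E]
  {M : Type*} [TopologicalSpace M] [ChartedSpace E M]

theorem norm_delAt_sq (r : M → ℝ) (p : M) (v : TangentSpace 𝓘(ℝ, E) p) :
    ‖delAt r p v‖ ^ 2 = (1 / 4) * (dAt r p v ^ 2 + dAt r p (tangentJ p v) ^ 2) := by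
  rw [← Complex.normSq_eq_norm_sq, Complex.normSq_apply]
  simp [delAt]
  ring

variable [IsManifold 𝓘(ℂ, E) ω M]

theorem HermitianMetric.inner_J_self (g : HermitianMetric E M) (p : M)
    (v : TangentSpace 𝓘(ℝ, E) p) : g.inner p (tangentJ p v) v = 0 := by
  have h1 := g.inner_J_right p v v
  rw [g.symm p v (tangentJ p v)] at h1
  linarith

/-- `|∂r|² = |dr|² / 2`; here `G` is the gradient of `r`.  The supremum which defines `|∂r|` is
attained at a multiple of `G`. -/
theorem HermitianMetric.normDel_sq (g : HermitianMetric E M) {r : M → ℝ} {p : M}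
    {G : TangentSpace 𝓘(ℝ, E) p} (hG : ∀ v, g.inner p v G = dAt r p v) (hG0 : G ≠ 0) :
    g.normDel r p ^ 2 = (1 / 2) * g.inner p G G := by
  have hn : 0 < g.inner p G G := g.pos p G hG0
  set n := g.inner p G G with hndef
  have hherm : ∀ v : TangentSpace 𝓘(ℝ, E) p, (g.herm p v v).re = (1 / 2) * g.inner p v v := by
    intro v
    simp [HermitianMetric.herm]
  have hJG : ∀ v, dAt r p (tangentJ p v) = - g.inner p v (tangentJ p G) := fun v ↦ by
    rw [← hG, g.inner_J_right, neg_neg]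
  have hgr : IsGreatest {t : ℝ | ∃ v : TangentSpace 𝓘(ℝ, E) p,
      (g.herm p v v).re ≤ 1 ∧ t = ‖delAt r p v‖} (Real.sqrt ((1 / 2) * n)) := by
    constructor
    · refine ⟨Real.sqrt (2 / n) • G, ?_, ?_⟩
      · rw [hherm, map_smul, map_smul]
        simp only [smul_apply, smul_eq_mul]
        rw [← mul_assoc (Real.sqrt _), Real.mul_self_sqrt (by positivity), ← hndef]
        field_simp
        exact le_refl _
      · symm
        rw [← Real.sqrt_sq (norm_nonneg (delAt r p _)), norm_delAt_sq, map_smul, map_smul, map_smul,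
          ← hG, ← hG, g.inner_J_self, ← hndef]
        congr 1
        simp only [smul_eq_mul, mul_zero]
        rw [mul_pow, Real.sq_sqrt (by positivity)]
        field_simp
        ring
    · rintro _ ⟨v, hv, rfl⟩
      refine Real.le_sqrt_of_sq_le ?_
      rw [norm_delAt_sq, hJG, ← hG]
      rw [hherm] at hv
      -- Bessel's inequality for the orthogonal vectors `G` and `J G`
      set a := g.inner p v G with ha
      set b := g.inner p v (tangentJ p G) with hb
      have h1 : 0 ≤ g.inner p (v - (a / n) • G - (b / n) • tangentJ p G)
          (v - (a / n) • G - (b / n) • tangentJ p G) := by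
        by_cases h0 : v - (a / n) • G - (b / n) • tangentJ p G = 0
        · rw [h0]; simp
        · exact (g.pos p _ h0).le
      have h2 : g.inner p G v = a := g.symm p G v
      have h3 : g.inner p (tangentJ p G) v = b := g.symm p _ v
      have h4 : g.inner p G (tangentJ p G) = 0 := by
        rw [g.symm p G]; exact g.inner_J_self p G
      have h5 : g.inner p (tangentJ p G) (tangentJ p G) = n := g.inner_J p G G
      simp only [map_sub, map_smul, sub_apply, smul_apply,
        smul_eq_mul, h2, h3, h4, h5, g.inner_J_self, ← ha, ← hb, ← hndef] at h1
      have h6 : a ^ 2 + b ^ 2 ≤ n * g.inner p v v := by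
        field_simp at h1
        nlinarith
      nlinarith
  rw [HermitianMetric.normDel, hgr.csSup_eq, Real.sq_sqrt (by positivity)]

variable [FiniteDimensional ℂ E]

theorem HermitianMetric.exists_gradient (g : HermitianMetric E M) (r : M → ℝ) (p : M) :
    ∃ G : TangentSpace 𝓘(ℝ, E) p, ∀ v, g.inner p v G = dAt r p v := by
  have : FiniteDimensional ℝ (TangentSpace 𝓘(ℝ, E) p) :=
    inferInstanceAs (FiniteDimensional ℝ E)
  let B : TangentSpace 𝓘(ℝ, E) p →ₗ[ℝ] Module.Dual ℝ (TangentSpace 𝓘(ℝ, E) p) :=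
    { toFun := fun v ↦ (g.inner p v : TangentSpace 𝓘(ℝ, E) p →ₗ[ℝ] ℝ)
      map_add' := by intro v w; ext x; simp
      map_smul' := by intro v w; ext x; simp }
  have hinj : Function.Injective B := by
    rw [← LinearMap.ker_eq_bot, LinearMap.ker_eq_bot']
    intro v hv
    by_contra hne
    have h1 := g.pos p v hne
    have h2 : B v v = 0 := by rw [hv]; rfl
    exact absurd h2 h1.ne'
  obtain ⟨G, hG⟩ := (LinearMap.injective_iff_surjective_of_finrank_eq_finrank
    (Subspace.dual_finrank_eq).symm).1 hinj (dAt r p)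
  refine ⟨G, fun w ↦ ?_⟩
  rw [g.symm p w G]
  exact congrArg (fun f ↦ f w) hG

/-- `∂r(L_r) = 1`, in terms of real vectors.  This is all that is needed about `L_r`: modulo complex
tangent vectors of the level sets of `r` it determines `L_r`. -/
theorem HermitianMetric.dAt_L (g : HermitianMetric E M) {r : M → ℝ} {p : M}
    (hp : dAt (E := E) r p ≠ 0) :
    dAt r p (g.L r p) = 2 ∧ dAt r p (tangentJ p (g.L r p)) = 0 := by
  obtain ⟨G, hG⟩ := g.exists_gradient r p
  have hG0 : G ≠ 0 := by
    rintro rfl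
    refine hp (LinearMap.ext fun v ↦ ?_)
    rw [← hG]
    simp
  have hn : 0 < g.inner p G G := g.pos p G hG0
  have hN := g.normDel_sq hG hG0
  have hL : g.L r p = (g.normDel r p ^ 2)⁻¹ • G := by
    refine (g.existsUnique_L r p).unique (g.existsUnique_L r p).choose_spec.1 fun v ↦ ?_
    rw [HermitianMetric.herm, g.inner_J_right, map_smul, map_smul, smul_eq_mul, smul_eq_mul, hG, hG,
      delAt]
    push_cast
    ring
  rw [hL, map_smul, map_smul, map_smul, ← hG, ← hG, g.inner_J_self, hN]
  simp only [smul_eq_mul, mul_zero, and_true]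
  field_simp

end NormalField

section ComplexLinear

open ContinuousLinearMap

variable {E G : Type*} [NormedAddCommGroup E] [NormedSpace ℂ E]
  [NormedAddCommGroup G] [NormedSpace ℂ G]

theorem fderiv_real_I_smul {T : E → G} {z : E} (hT : ContDiffAt ℂ 2 T z) (v : E) :
    fderiv ℝ T z (Complex.I • v) = Complex.I • fderiv ℝ T z v := by
  rw [(hT.differentiableAt two_ne_zero).fderiv_restrictScalars ℝ]
  simp

/-- The second real derivative of a holomorphic map is complex bilinear. -/
theorem fderiv_fderiv_real_I_smul {T : E → G} {z : E} (hT : ContDiffAt ℂ 2 T z) (v w : E) :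
    fderiv ℝ (fderiv ℝ T) z (Complex.I • v) (Complex.I • w) = -fderiv ℝ (fderiv ℝ T) z v w := by
  have hT1 : DifferentiableAt ℂ (fderiv ℂ T) z :=
    (hT.fderiv_right (m := 1) le_rfl).differentiableAt one_ne_zero
  have hev : ∀ᶠ y in 𝓝 z, ContDiffAt ℂ 2 T y := hT.eventually (by simp)
  have hTR : ContDiffAt ℝ 2 T z := hT.restrict_scalars ℝ
  have key : ∀ v w, fderiv ℝ (fderiv ℝ T) z v w = fderiv ℂ (fderiv ℂ T) z v w := by
    intro v w
    have h1 : HasFDerivAt (fun y ↦ fderiv ℝ T y w) ((fderiv ℝ (fderiv ℝ T) z).flip w) z := by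
      simpa using! (differentiableAt_fderiv_of_contDiffAt hTR).hasFDerivAt.clm_apply
        (hasFDerivAt_const w z)
    have h2 : HasFDerivAt (fun y ↦ fderiv ℂ T y w) ((fderiv ℂ (fderiv ℂ T) z).flip w) z := by
      simpa using! hT1.hasFDerivAt.clm_apply (hasFDerivAt_const w z)
    have h3 : (fun y ↦ fderiv ℝ T y w) =ᶠ[𝓝 z] fun y ↦ fderiv ℂ T y w := by
      filter_upwards [hev] with y hy
      rw [(hy.differentiableAt two_ne_zero).fderiv_restrictScalars ℝ]
      simp
    have h4 := h1.unique ((h2.restrictScalars ℝ).congr_of_eventuallyEq h3)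
    simpa using! congrArg (fun f : E →L[ℝ] G ↦ f v) h4
  rw [key, key, map_smul, map_smul, smul_apply, smul_smul, Complex.I_mul_I,
    neg_one_smul]

end ComplexLinear

/-! ### Holomorphic charts -/

section Chart

open Filter

variable {E : Type*} [NormedAddCommGroup E] [NormedSpace ℂ E]
  {M : Type*} [TopologicalSpace M] [ChartedSpace E M]

/-- The differential at `p` of a chart `ψ`. -/
def chartDeriv (ψ : OpenPartialHomeomorph M E) (p : M) : TangentSpace 𝓘(ℝ, E) p →L[ℝ] E :=
  mfderiv 𝓘(ℝ, E) 𝓘(ℝ, E) ψ p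

variable {ψ : OpenPartialHomeomorph M E} {p : M}

theorem mem_contDiffGroupoid_real {e : OpenPartialHomeomorph E E}
    (he : e ∈ contDiffGroupoid ω 𝓘(ℂ, E)) : e ∈ contDiffGroupoid ω 𝓘(ℝ, E) := by
  rw [contDiffGroupoid, mem_groupoid_of_pregroupoid] at he ⊢
  have h1 : ContDiffOn ℂ ω (𝓘(ℂ, E) ∘ e ∘ 𝓘(ℂ, E).symm)
    (𝓘(ℂ, E).symm ⁻¹' e.source ∩ Set.range 𝓘(ℂ, E)) := he.1
  have h2 : ContDiffOn ℂ ω (𝓘(ℂ, E) ∘ e.symm ∘ 𝓘(ℂ, E).symm)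
    (𝓘(ℂ, E).symm ⁻¹' e.target ∩ Set.range 𝓘(ℂ, E)) := he.2
  exact ⟨h1.restrict_scalars ℝ, h2.restrict_scalars ℝ⟩

theorem mem_maximalAtlas_real (hψ : ψ ∈ IsManifold.maximalAtlas 𝓘(ℂ, E) ω M) :
    ψ ∈ IsManifold.maximalAtlas 𝓘(ℝ, E) ω M := fun e he ↦
  ⟨mem_contDiffGroupoid_real (hψ e he).1, mem_contDiffGroupoid_real (hψ e he).2⟩

theorem mdifferentiableAt_chart (hψ : ψ ∈ IsManifold.maximalAtlas 𝓘(ℂ, E) ω M)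
    (hp : p ∈ ψ.source) : MDifferentiableAt 𝓘(ℝ, E) 𝓘(ℝ, E) ψ p :=
  (contMDiffAt_of_mem_maximalAtlas (mem_maximalAtlas_real hψ) hp).mdifferentiableAt (by simp)

theorem chartDeriv_surjective (hψ : ψ ∈ IsManifold.maximalAtlas 𝓘(ℂ, E) ω M) (hp : p ∈ ψ.source) :
    Function.Surjective (chartDeriv ψ p) := by
  have h : ψ.MDifferentiable 𝓘(ℝ, E) 𝓘(ℝ, E) :=
    ⟨(contMDiffOn_of_mem_maximalAtlas (mem_maximalAtlas_real hψ)).mdifferentiableOn (by simp),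
      (contMDiffOn_symm_of_mem_maximalAtlas (mem_maximalAtlas_real hψ)).mdifferentiableOn (by simp)⟩
  exact h.mfderiv_surjective hp

/-- The function `r` near `p`, read in the chart `ψ`, is of class `C²` if `r` is. -/
theorem contDiffAt_comp_symm {r : M → ℝ} (hψ : ψ ∈ IsManifold.maximalAtlas 𝓘(ℂ, E) ω M)
    (hp : p ∈ ψ.source) (hr : ContMDiffAt 𝓘(ℝ, E) 𝓘(ℝ, ℝ) 2 r p) :
    ContDiffAt ℝ 2 (r ∘ ψ.symm) (ψ p) := by
  have h1 : ContMDiffAt 𝓘(ℝ, E) 𝓘(ℝ, E) 2 ψ.symm (ψ p) :=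
    (contMDiffAt_symm_of_mem_maximalAtlas (mem_maximalAtlas_real hψ) (ψ.map_source hp)).of_le le_top
  have h2 : ContMDiffAt 𝓘(ℝ, E) 𝓘(ℝ, ℝ) 2 r (ψ.symm (ψ p)) := by rwa [ψ.left_inv hp]
  exact (h2.comp _ h1).contDiffAt

theorem dAt_eq {r : M → ℝ} (hψ : ψ ∈ IsManifold.maximalAtlas 𝓘(ℂ, E) ω M)
    (hp : p ∈ ψ.source) (hr : ContMDiffAt 𝓘(ℝ, E) 𝓘(ℝ, ℝ) 2 r p) (v : TangentSpace 𝓘(ℝ, E) p) :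
    dAt r p v = fderiv ℝ (r ∘ ψ.symm) (ψ p) (chartDeriv ψ p v) := by
  have h1 : r =ᶠ[𝓝 p] (r ∘ ψ.symm) ∘ ψ := by
    filter_upwards [ψ.open_source.mem_nhds hp] with q hq
    simp [ψ.left_inv hq]
  have h2 := (contDiffAt_comp_symm hψ hp hr).differentiableAt two_ne_zero
  rw [dAt_apply, h1.mfderiv_eq, mfderiv_comp p h2.mdifferentiableAt (mdifferentiableAt_chart hψ hp),
    mfderiv_eq_fderiv]
  rfl

theorem chartDeriv_eq (hψ : ψ ∈ IsManifold.maximalAtlas 𝓘(ℂ, E) ω M) (hp : p ∈ ψ.source)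
    (v : TangentSpace 𝓘(ℝ, E) p) :
    chartDeriv ψ p v = fderiv ℝ (ψ ∘ (chartAt E p).symm) (chartAt E p p) v := by
  rw [chartDeriv, (mdifferentiableAt_chart hψ hp).mfderiv]
  simp [writtenInExtChartAt, fderivWithin_univ]
  rfl

variable [IsManifold 𝓘(ℂ, E) ω M]

theorem contDiffAt_transition (hψ : ψ ∈ IsManifold.maximalAtlas 𝓘(ℂ, E) ω M) (hp : p ∈ ψ.source) :
    ContDiffAt ℂ 2 (ψ ∘ (chartAt E p).symm) (chartAt E p p) := by
  have h1 : ContMDiffAt 𝓘(ℂ, E) 𝓘(ℂ, E) ω ψ p :=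
    contMDiffAt_of_mem_maximalAtlas hψ hp
  have h2 : ContMDiffAt 𝓘(ℂ, E) 𝓘(ℂ, E) ω (chartAt E p).symm (chartAt E p p) :=
    contMDiffAt_symm_of_mem_maximalAtlas (IsManifold.chart_mem_maximalAtlas p)
      (mem_chart_target E p)
  have h3 : ContMDiffAt 𝓘(ℂ, E) 𝓘(ℂ, E) ω ψ ((chartAt E p).symm (chartAt E p p)) := by
    rwa [(chartAt E p).left_inv (mem_chart_source E p)]
  exact ((h3.comp _ h2).contDiffAt).of_le le_top

/-- The complex structure `J` is multiplication by `i` in every holomorphic chart. -/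
theorem chartDeriv_tangentJ (hψ : ψ ∈ IsManifold.maximalAtlas 𝓘(ℂ, E) ω M) (hp : p ∈ ψ.source)
    (v : TangentSpace 𝓘(ℝ, E) p) :
    chartDeriv ψ p (tangentJ p v) = Complex.I • chartDeriv ψ p v := by
  rw [chartDeriv_eq hψ hp, chartDeriv_eq hψ hp]
  exact fderiv_real_I_smul (contDiffAt_transition hψ hp) v

/-- The `J`-invariant part of the second derivative of `r` can be computed in any holomorphic chart:
the second derivative of a holomorphic transition map is complex bilinear, so that its contribution
cancels. -/
theorem hessAt_add_hessAt_eq {r : M → ℝ} (hψ : ψ ∈ IsManifold.maximalAtlas 𝓘(ℂ, E) ω M)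
    (hp : p ∈ ψ.source) (hr : ContMDiffAt 𝓘(ℝ, E) 𝓘(ℝ, ℝ) 2 r p) (v w : TangentSpace 𝓘(ℝ, E) p) :
    hessAt r p v w + hessAt r p (tangentJ p v) (tangentJ p w) =
      fderiv ℝ (fderiv ℝ (r ∘ ψ.symm)) (ψ p) (chartDeriv ψ p v) (chartDeriv ψ p w) +
      fderiv ℝ (fderiv ℝ (r ∘ ψ.symm)) (ψ p) (Complex.I • chartDeriv ψ p v)
        (Complex.I • chartDeriv ψ p w) := by
  have hc := (chartAt E p).left_inv (mem_chart_source E p)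
  have hT := contDiffAt_transition hψ hp
  have hT' : ContDiffAt ℝ 2 (ψ ∘ (chartAt E p).symm) (chartAt E p p) := hT.restrict_scalars ℝ
  have hTp : (ψ ∘ (chartAt E p).symm) (chartAt E p p) = ψ p := by
    rw [Function.comp_apply, hc]
  have h1 : r ∘ (chartAt E p).symm =ᶠ[𝓝 (chartAt E p p)]
      (r ∘ ψ.symm) ∘ (ψ ∘ (chartAt E p).symm) := by
    have h2 : ∀ᶠ z in 𝓝 (chartAt E p p), (chartAt E p).symm z ∈ ψ.source := by
      refine ((chartAt E p).continuousAt_symm (mem_chart_target E p)).eventually ?_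
      rw [hc]
      exact ψ.open_source.mem_nhds hp
    filter_upwards [h2] with z hz
    simp [ψ.left_inv hz]
  have hr2 : ContDiffAt ℝ 2 (r ∘ ψ.symm) ((ψ ∘ (chartAt E p).symm) (chartAt E p p)) := by
    rw [hTp]; exact contDiffAt_comp_symm hψ hp hr
  have key : ∀ v w : E, fderiv ℝ (fderiv ℝ (r ∘ (chartAt E p).symm)) (chartAt E p p) v w =
      fderiv ℝ (fderiv ℝ (r ∘ ψ.symm)) (ψ p)
        (fderiv ℝ (ψ ∘ (chartAt E p).symm) (chartAt E p p) v)
        (fderiv ℝ (ψ ∘ (chartAt E p).symm) (chartAt E p p) w) +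
      fderiv ℝ (r ∘ ψ.symm) (ψ p)
        (fderiv ℝ (fderiv ℝ (ψ ∘ (chartAt E p).symm)) (chartAt E p p) v w) := by
    intro v w
    rw [(h1.fderiv (𝕜 := ℝ)).fderiv_eq, fderiv_fderiv_comp_apply hr2 hT', hTp]
  rw [← chartDeriv_tangentJ hψ hp, ← chartDeriv_tangentJ hψ hp]
  have e1 : ∀ a b : E, fderiv ℝ (fderiv ℝ (r ∘ (chartAt E p).symm)) (chartAt E p p)
      (Complex.I • a) (Complex.I • b) = _ := fun a b ↦ key (Complex.I • a) (Complex.I • b)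
  simp only [fderiv_fderiv_real_I_smul hT, map_neg] at e1
  simp only [chartDeriv_eq hψ hp]
  refine (congrArg₂ (· + ·) (key v w) (e1 v w)).trans ?_
  have e2 : ∀ v : TangentSpace 𝓘(ℝ, E) p, tangentJ p v = (Complex.I • (id v : E) : E) :=
    fun _ ↦ rfl
  rw [e2, e2]
  simp only [id]
  ring

end Chart

/-! ### Pullback to a complex submanifold of the boundary -/

section Main

open Filter

variable {E : Type*} [NormedAddCommGroup E] [NormedSpace ℂ E]
  {M : Type*} [TopologicalSpace M] [ChartedSpace E M]
  {ψ : OpenPartialHomeomorph M E} {p : M} {Ω U : Set M} {r : M → ℝ}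

theorem complexHessian_re (r : M → ℝ) (p : M) (v w : TangentSpace 𝓘(ℝ, E) p) :
    (complexHessian r p v w).re =
      (1 / 4) * (hessAt r p v w + hessAt r p (tangentJ p v) (tangentJ p w)) := by
  simp [complexHessian]

theorem delAt_eq_zero_iff (r : M → ℝ) (p : M) (v : TangentSpace 𝓘(ℝ, E) p) :
    delAt r p v = 0 ↔ dAt r p v = 0 ∧ dAt r p (tangentJ p v) = 0 := by
  rw [delAt, Complex.ext_iff]
  simp

theorem IsDefiningFunction.contMDiffAt (hr : IsDefiningFunction (E := E) Ω U r)
    (hp : p ∈ frontier Ω) : ContMDiffAt 𝓘(ℝ, E) 𝓘(ℝ, ℝ) 2 r p :=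
  hr.contMDiffOn.contMDiffAt (hr.isOpen.mem_nhds (hr.frontier_subset hp))

variable [IsManifold 𝓘(ℂ, E) ω M]

/-- Pseudoconvexity at boundary points, read in an arbitrary holomorphic chart. -/
theorem IsLeviPseudoconvex.leviNonneg (hΩ : IsLeviPseudoconvex E Ω)
    (hr : IsDefiningFunction (E := E) Ω U r)
    (hψ : ψ ∈ IsManifold.maximalAtlas 𝓘(ℂ, E) ω M) (hp : p ∈ ψ.source) (hpΩ : p ∈ frontier Ω) :
    LeviNonneg (r ∘ ψ.symm) (ψ p) := by
  intro w h1 h2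
  obtain ⟨v, rfl⟩ := chartDeriv_surjective hψ hp w
  have hrp := hr.contMDiffAt hpΩ
  have h3 := hΩ.2 U r hr p hpΩ v ((delAt_eq_zero_iff r p v).2
    ⟨by rw [dAt_eq hψ hp hrp, h1], by rw [dAt_eq hψ hp hrp, chartDeriv_tangentJ hψ hp, h2]⟩)
  rw [complexHessian_re, hessAt_add_hessAt_eq hψ hp hrp] at h3
  linarith

variable [FiniteDimensional ℂ E]

/-- D'Angelo's form in an arbitrary holomorphic chart. -/
theorem alpha_eq (g : HermitianMetric E M) (hψ : ψ ∈ IsManifold.maximalAtlas 𝓘(ℂ, E) ω M)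
    (hp : p ∈ ψ.source) (hr : ContMDiffAt 𝓘(ℝ, E) 𝓘(ℝ, ℝ) 2 r p) (v : TangentSpace 𝓘(ℝ, E) p) :
    alpha g r p v = (1 / 2) *
      (fderiv ℝ (fderiv ℝ (r ∘ ψ.symm)) (ψ p) (chartDeriv ψ p v) (chartDeriv ψ p (g.L r p)) +
      fderiv ℝ (fderiv ℝ (r ∘ ψ.symm)) (ψ p) (Complex.I • chartDeriv ψ p v)
        (Complex.I • chartDeriv ψ p (g.L r p))) := by
  have hs := (contDiffAt_comp_symm hψ hp hr).isSymmSndFDerivAt (by simp)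
  change (complexHessian r p v (g.L r p) + complexHessian r p (g.L r p) v).re = _
  rw [Complex.add_re, complexHessian_re, complexHessian_re, hessAt_add_hessAt_eq hψ hp hr,
    hessAt_add_hessAt_eq hψ hp hr, hs.eq (chartDeriv ψ p (g.L r p)),
    hs.eq (Complex.I • chartDeriv ψ p (g.L r p))]
  ring

/-- The pullback of `α_r` to a complex submanifold of the boundary is locally exact: in adapted
charts the inclusion is a complex linear map `j`. -/
theorem isLocallyExact_pullback_alpha (g : HermitianMetric E M) (hΩ : IsLeviPseudoconvex E Ω)
    (hr : IsDefiningFunction (E := E) Ω U r)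
    {F : Type*} [NormedAddCommGroup F] [NormedSpace ℂ F] [FiniteDimensional ℂ F]
    {S : Type*} [TopologicalSpace S] [ChartedSpace F S] [IsManifold 𝓘(ℂ, F) ω S]
    {ι : S → M} (hι : Manifold.IsImmersion 𝓘(ℂ, F) 𝓘(ℂ, E) ω ι) (hS : ∀ q, ι q ∈ frontier Ω) :
    ((alpha g r).pullback ι : OneForm F S).IsLocallyExact := by
  intro q
  have h := hι.isImmersionAt q
  let φ := h.domChart
  let ψ := h.codChart
  have hφ : φ ∈ IsManifold.maximalAtlas 𝓘(ℂ, F) ω S := h.domChart_mem_maximalAtlas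
  have hψ : ψ ∈ IsManifold.maximalAtlas 𝓘(ℂ, E) ω M := h.codChart_mem_maximalAtlas
  have hφψ : ∀ y ∈ φ.source, ι y ∈ ψ.source := fun y hy ↦ h.source_subset_preimage_source hy
  let j : F →L[ℂ] E := (h.equiv : (F × h.complement) →L[ℂ] E).comp
    (ContinuousLinearMap.inl ℂ F h.complement)
  have hj : ∀ y ∈ φ.source, ψ (ι y) = j (φ y) := by
    intro y hy
    have hmem : φ y ∈ (h.domChart.extend 𝓘(ℂ, F)).target := by
      simpa using φ.map_source hy
    have h1 := h.writtenInCharts hmem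
    have h2 : (h.domChart.extend 𝓘(ℂ, F)).symm (φ y) = y := φ.left_inv hy
    rw [Function.comp_apply, Function.comp_apply, h2] at h1
    exact h1
  have hj' : ∀ x ∈ φ.target, j x ∈ ψ.target ∧ ψ.symm (j x) = ι (φ.symm x) := by
    intro x hx
    have h1 := hj _ (φ.map_target hx)
    rw [φ.right_inv hx] at h1
    have h2 := hφψ _ (φ.map_target hx)
    rw [← h1]
    exact ⟨ψ.map_source h2, ψ.left_inv h2⟩
  have hq : q ∈ φ.source := h.mem_domChart_source
  have hιq := hφψ q hq
  have hrq := hr.contMDiffAt (hS q)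
  have hjq : j (φ q) = ψ (ι q) := (hj q hq).symm
  have h0 : ∀ᶠ x in 𝓝 (φ q), (r ∘ ψ.symm) (j x) = 0 := by
    filter_upwards [φ.open_target.mem_nhds (φ.map_source hq)] with x hx
    rw [Function.comp_apply, (hj' x hx).2]
    exact (hr.zero_iff _ (hr.frontier_subset (hS _))).2 (hS _)
  have hL : ∀ᶠ y in 𝓝 (j (φ q)), (r ∘ ψ.symm) y = 0 → LeviNonneg (r ∘ ψ.symm) y := by
    rw [hjq]
    have h1 : ∀ᶠ y in 𝓝 (ψ (ι q)), ψ.symm y ∈ U := by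
      refine (ψ.continuousAt_symm (ψ.map_source hιq)).eventually ?_
      rw [ψ.left_inv hιq]
      exact hr.isOpen.mem_nhds (hr.frontier_subset (hS q))
    filter_upwards [h1, ψ.open_target.mem_nhds (ψ.map_source hιq)] with y hyU hy hy0
    have h2 := hΩ.leviNonneg hr hψ (ψ.map_target hy) ((hr.zero_iff _ hyU).1 hy0)
    rwa [ψ.right_inv hy] at h2
  have hd : fderiv ℝ (r ∘ ψ.symm) (j (φ q)) ≠ 0 := by
    intro hd
    refine hr.d_ne_zero _ (hS q) (LinearMap.ext fun v ↦ ?_)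
    rw [dAt_eq hψ hιq hrq, ← hjq, hd]
    rfl
  have hr2 : ContDiffAt ℝ 2 (r ∘ ψ.symm) (j (φ q)) := by
    rw [hjq]; exact contDiffAt_comp_symm hψ hιq hrq
  obtain ⟨u, hu⟩ := exists_primitive_of_leviNonneg hr2 h0 hL hd
  obtain ⟨W, hWu, hW, hqW⟩ := _root_.eventually_nhds_iff.1 hu
  have hφR := mem_maximalAtlas_real hφ
  refine ⟨φ.source ∩ φ ⁻¹' W, φ.isOpen_inter_preimage hW, ⟨hq, hqW⟩, u ∘ φ, ?_, ?_⟩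
  · intro y hy
    have h1 : ContMDiffAt 𝓘(ℝ, F) 𝓘(ℝ, F) 1 φ y :=
      (contMDiffAt_of_mem_maximalAtlas hφR hy.1).of_le (by simp)
    exact ((hWu _ hy.2).1.contMDiffAt.comp y h1).contMDiffWithinAt
  · intro y hy
    ext v
    have hyψ := hφψ y hy.1
    have hry := hr.contMDiffAt (hS y)
    have hφy : MDifferentiableAt 𝓘(ℝ, F) 𝓘(ℝ, F) φ y := mdifferentiableAt_chart hφ hy.1
    have hψy : MDifferentiableAt 𝓘(ℝ, E) 𝓘(ℝ, E) ψ (ι y) := mdifferentiableAt_chart hψ hyψ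
    let jr : F →L[ℝ] E := j.restrictScalars ℝ
    have hιy : MDifferentiableAt 𝓘(ℝ, F) 𝓘(ℝ, E) ι y := by
      have h1 : ι =ᶠ[𝓝 y] ψ.symm ∘ jr ∘ φ := by
        filter_upwards [φ.open_source.mem_nhds hy.1] with z hz
        exact (ψ.left_inv (hφψ z hz)).symm.trans (congrArg ψ.symm (hj z hz))
      have h2 : jr (φ y) ∈ ψ.target := (hj' _ (φ.map_source hy.1)).1
      have h3 : MDifferentiableAt 𝓘(ℝ, E) 𝓘(ℝ, E) ψ.symm (jr (φ y)) :=
        (contMDiffAt_symm_of_mem_maximalAtlas (mem_maximalAtlas_real hψ) h2).mdifferentiableAt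
          (by simp)
      exact (h3.comp y (jr.differentiableAt.mdifferentiableAt.comp y hφy)).congr_of_eventuallyEq h1
    -- the differential of `ι`, read in the charts, is `j`
    have hchain : chartDeriv ψ (ι y) (mfderiv 𝓘(ℝ, F) 𝓘(ℝ, E) ι y v) =
        j (chartDeriv φ y v) := by
      have h1 : ψ ∘ ι =ᶠ[𝓝 y] jr ∘ φ := by
        filter_upwards [φ.open_source.mem_nhds hy.1] with z hz using hj z hz
      have h2 := h1.mfderiv_eq (I := 𝓘(ℝ, F)) (I' := 𝓘(ℝ, E))
      rw [mfderiv_comp y hψy hιy, mfderiv_comp y jr.differentiableAt.mdifferentiableAt hφy,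
        mfderiv_eq_fderiv, jr.fderiv] at h2
      exact congrArg (fun f : F →L[ℝ] E ↦ f v) h2
    have hdL := g.dAt_L (hr.d_ne_zero _ (hS y))
    rw [dAt_eq hψ hyψ hry, dAt_eq hψ hyψ hry, chartDeriv_tangentJ hψ hyψ, hj y hy.1] at hdL
    have h3 := (hWu _ hy.2).2 _ hdL.1 hdL.2 (chartDeriv φ y v)
    change alpha g r (ι y) (mfderiv 𝓘(ℝ, F) 𝓘(ℝ, E) ι y v) = _
    rw [alpha_eq g hψ hyψ hry, hchain, hj y hy.1, ← h3, dAt_apply,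
      mfderiv_comp y ((hWu _ hy.2).1.differentiableAt one_ne_zero).mdifferentiableAt hφy,
      mfderiv_eq_fderiv]
    rfl

end Main

end DAngelo

end

theorem proposition5p1
    {E : Type*} [NormedAddCommGroup E] [NormedSpace ℂ E] [FiniteDimensional ℂ E]
    (hn : 2 ≤ Module.finrank ℂ E)
    {M : Type*} [TopologicalSpace M] [T2Space M] [SecondCountableTopology M]
    [ChartedSpace E M] [IsManifold 𝓘(ℂ, E) ω M]
    (g : DAngelo.HermitianMetric E M)
    (Ω : Set M) (hΩ_open : IsOpen Ω) (hΩ_conn : IsConnected Ω) (hΩ_cpt : IsCompact (closure Ω))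
    (hΩ_psc : DAngelo.IsLeviPseudoconvex E Ω)
    (U : Set M) (r : M → ℝ) (hr : DAngelo.IsAdmissible g Ω U r)
    -- the complex submanifold `S`, with its (injectively immersed) inclusion `ι` into `M`
    {F : Type*} [NormedAddCommGroup F] [NormedSpace ℂ F] [FiniteDimensional ℂ F]
    [MeasurableSpace F] [BorelSpace F]
    (hm : 1 ≤ Module.finrank ℂ F)
    {S : Type*} [TopologicalSpace S] [ChartedSpace F S] [IsManifold 𝓘(ℂ, F) ω S]
    (ι : S → M) (hι : Manifold.IsImmersion 𝓘(ℂ, F) 𝓘(ℂ, E) ω ι) (hι_inj : Function.Injective ι)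
    (hS : ∀ q, ι q ∈ frontier Ω) :
    ((DAngelo.alpha g r).pullback ι : DAngelo.OneForm F S).IsWeaklyClosed ∧
      ((DAngelo.alpha g r).pullback ι : DAngelo.OneForm F S).IsLocallyExact := by
  have h := DAngelo.isLocallyExact_pullback_alpha g hΩ_psc hr.1 hι hS
  exact ⟨h.isWeaklyClosed, h⟩
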